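/- For a topological space $X$, a continuous map $f\colon X\to X$ and $x\in X$, put $\alpha_f(x)=\bigcap_{n\ge 0}\overline{\bigcup_{k\ge n} f^{-k}(x)}$. A metrizable space $X$ has the $\mathcal{AF}$-property if the closed subsets of $X$ are exactly the sets $\alpha_f(x)$ with $f\colon X\to X$ continuous and $x\in X$. Let $S=\{\langle x,\sin\frac1x\rangle : 0<x\le \frac2\pi\}\subseteq\mathbb R^2$ and let $X=\overline S\cup\{\langle x,-1\rangle : -1\le x\le 0\}$ be the extended sine curve. For $i\ge 1$ let $M_i(\langle x,y\rangle)=\langle -2-\frac1{2^i}-\frac{(\pi/2)x}{2^i},\,(-1)^{i+1}y\rangle$, let $S_\infty=\{-2\}\times[-1,1]$, $W=S_\infty\cup\bigcup_{i\ge1}M_i(\overline S)$ and $Z=W\cup X$. Let $\sim$ be the equivalence relation (on $Z$, and likewise on $W$) that identifies all points of $S_\infty$ with each other and makes no other identification. A chain of sine curves is a metrizable space $Y$ which is the union of homeomorphic copies $\overline{S}_i$ ($i\ge1$) of $\overline S$ and a point $s_\infty$ lying in none of them, to which they converge (every neighbourhood of $s_\infty$ contains all but finitely many $\overline S_i$),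 such that $\overline S_i\cap\overline S_{i+1}$ is a single point $b_i$ for each $i$, $\overline S_i\cap \overline S_j=\emptyset$ if $|i-j|\ge2$, and $b_i$ corresponds to one of the points $\langle 0,\pm1\rangle$ in $\overline S_i$ and to the point $\langle\frac2\pi,1\rangle$ in $\overline S_{i+1}$. **Theorem.** The space $Z\subseteq\mathbb R^2$ is a compact metrizable space with the $\mathcal{AF}$-property, while the quotient space $Z/_\sim$ is a compact metrizable space which does not have the $\mathcal{AF}$-property. Moreover, $W/_\sim$ is a chain of sine curves and $Z/_\sim$ is homeomorphic to the topological sum $X\oplus W/_\sim$. -/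

import Mathlib

open Set Filter Topology

noncomputable section

/-- The `α`-limit set of a point `x` under a self-map `f`:
`⋂ n, closure (⋃ k ≥ n, f⁻ᵏ(x))`. -/
def alphaLimitSet {X : Type*} [TopologicalSpace X] (f : X → X) (x : X) : Set X :=
  ⋂ n : ℕ, closure (⋃ k : ℕ, ⋃ _ : n ≤ k, f^[k] ⁻¹' {x})

/-- `A` is an `α`-limit set in `X`: it is the `α`-limit set of some point under some continuous
self-map of `X`. -/
def IsAlphaLimitSet {X : Type*} [TopologicalSpace X] (A : Set X) : Prop :=
  ∃ f : X → X, Continuous f ∧ ∃ x : X, A = alphaLimitSet f x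

/-- The `𝒜ℱ`-property: the family of `α`-limit sets coincides with the family of closed sets.
(Metrizability of the space is always stated separately.) -/
def HasAFProperty (X : Type*) [TopologicalSpace X] : Prop :=
  {A : Set X | IsAlphaLimitSet A} = {A : Set X | IsClosed A}

/-- The topologist's sine curve `S = {(x, sin (1/x)) : 0 < x ≤ 2/π}`.  Its closure is the closed
topologist's sine curve, with convergence continuum the segment from `(0, 1)` to `(0, -1)`. -/
def sineCurve : Set (ℝ × ℝ) :=
  {p | 0 < p.1 ∧ p.1 ≤ 2 / Real.pi ∧ p.2 = Real.sin (1 / p.1)}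

/-- The extended sine curve: the closed topologist's sine curve together with the horizontal
segment from `(0, -1)` to `(-1, -1)`. -/
def extendedSineCurve : Set (ℝ × ℝ) :=
  closure sineCurve ∪ {p | -1 ≤ p.1 ∧ p.1 ≤ 0 ∧ p.2 = -1}

/-- The affine maps `M i (x, y) = (-2 - 1/2^i - (π/2) x / 2^i, (-1)^(i+1) y)`. -/
def chainMap (i : ℕ) (p : ℝ × ℝ) : ℝ × ℝ :=
  (-2 - 1 / 2 ^ i - (Real.pi / 2) * p.1 / 2 ^ i, (-1) ^ (i + 1) * p.2)

/-- The limit arc `S_∞ = {-2} × [-1, 1]`. -/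
def limitArc : Set (ℝ × ℝ) :=
  {p | p.1 = -2 ∧ -1 ≤ p.2 ∧ p.2 ≤ 1}

/-- The sequence of closed sine curves `M i (closure S)`, `i ≥ 1`, converging to the arc `S_∞`,
together with that arc. -/
def sineCurvesToArc : Set (ℝ × ℝ) :=
  limitArc ∪ ⋃ i : ℕ, ⋃ _ : 1 ≤ i, chainMap i '' closure sineCurve

/-- The planar space `Z`: the union of the sine curves converging to an arc and the extended
sine curve. -/
def spaceZ : Set (ℝ × ℝ) :=
  sineCurvesToArc ∪ extendedSineCurve

/-- The equivalence relation on a subspace `T` of the plane which identifies all points of `T`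
lying in `A` with each other and makes no other identification. -/
def collapseSetoid (T A : Set (ℝ × ℝ)) : Setoid T where
  r p q := p = q ∨ ((p : ℝ × ℝ) ∈ A ∧ (q : ℝ × ℝ) ∈ A)
  iseqv :=
    { refl := fun _ => Or.inl rfl
      symm := by
        rintro p q (h | ⟨h₁, h₂⟩)
        · exact Or.inl h.symm
        · exact Or.inr ⟨h₂, h₁⟩
      trans := by
        rintro p q r (rfl | ⟨h₁, h₂⟩) (rfl | ⟨h₃, h₄⟩)
        · exact Or.inl rfl
        · exact Or.inr ⟨h₃, h₄⟩
        · exact Or.inr ⟨h₁, h₂⟩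
        · exact Or.inr ⟨h₁, h₄⟩ }

/-- A chain of sine curves: a metrizable space `Y` which is the union of a sequence of closed
topologist's sine curves (the images of embeddings `φ i`) and a point `s` outside all of them to
which they converge, such that the `i`-th and `(i+1)`-st curves meet exactly in a point `b i`,
other pairs of curves are disjoint, `b i` is one of the two endpoints of the convergence continuum
of the `i`-th curve, and `b i` is the endpoint of the `(i+1)`-st open sine curve. -/
def IsChainOfSineCurves (Y : Type*) [TopologicalSpace Y] : Prop :=
  TopologicalSpace.MetrizableSpace Y ∧
  ∃ (s : Y) (φ : ℕ → closure sineCurve → Y) (b : ℕ → Y),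
    (∀ i, IsEmbedding (φ i)) ∧
    (⋃ i, range (φ i)) ∪ {s} = univ ∧
    (∀ i, s ∉ range (φ i)) ∧
    (∀ U ∈ 𝓝 s, ∀ᶠ i in atTop, range (φ i) ⊆ U) ∧
    (∀ i, range (φ i) ∩ range (φ (i + 1)) = {b i}) ∧
    (∀ i j, i + 1 < j → Disjoint (range (φ i)) (range (φ j))) ∧
    (∀ i, ∃ p : closure sineCurve,
      ((p : ℝ × ℝ) = (0, 1) ∨ (p : ℝ × ℝ) = (0, -1)) ∧ φ i p = b i) ∧
    (∀ i, ∃ p : closure sineCurve, (p : ℝ × ℝ) = (2 / Real.pi, 1) ∧ φ (i + 1) p = b i)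

end

/-! Compactness settles the quotients and the sum decompositions. The content lies in the α-limit
sets: they are always closed, so the question is which closed sets are realized.

For Z, the sum of W and X, let A be closed. If A meets a path component without containing it, take
a path that leaves A for good and send each point to a time on it governed by its distance to A;
then A is the fibre, at every positive time, over one of its points (`isAlphaLimitSet_of_joined`).
Otherwise A is a union of path components, and closedness leaves a short list
(`closed_saturated_extended`, `closed_saturated_sineCurvesToArc`). Empty or clopen A come from
locally constant maps. The others are preimages, under a retraction, of the convergence segment of a
closed sine curve or of the limit arc. The folding map cos θ ↦ cos 3θ of the segment extends to the
closed sine curve and to W; it fixes the lower end, whose iterated preimages are dense in the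
segment, and this density lifts through the retraction (`isAlphaLimitSet_preimage_of_sections`).
When A consists of the arc and of the complement of the sine curve in X, the arc is matched with the
segment by `chainLap`; collapsing the arc destroys exactly this.

In the quotient, let L be the complement of the sine curve in X, which is an arc, and let B be L
with the limit point of the chain added. Suppose B is the α-limit set of x under f. Then B is
forward invariant, and a compact set off B reaches x only at bounded times. It follows that f maps X
to X and that x lies in L. The sine curve is mapped to itself: otherwise f maps X into L, and
intermediate values force f or its square to be constant on the sine curve
(`fst_pos_of_dense_preimages`), against `not_const_sine`. So inside X only points of L ever reach x.
The chain has to be mapped to X, since preimages of x accumulate at its limit point. A compact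
connected part of the chain that avoids the limit point and goes into L goes to a single point,
because a nondegenerate image would contain late preimages of x. By the oscillation of the sine
curve this constancy spreads over the whole chain (`const_of_const_on_compacts`), which
`not_const_chain` forbids. -/

noncomputable section

/-! ### Geometry of the closed and the extended sine curve -/

theorem mem_closure_sineCurve {p : ℝ × ℝ} : p ∈ closure sineCurve ↔
    (p.1 = 0 ∧ -1 ≤ p.2 ∧ p.2 ≤ 1) ∨
      (0 < p.1 ∧ p.1 ≤ 2 / Real.pi ∧ p.2 = Real.sin (1 / p.1)) := by
  constructor
  · intro hp
    obtain ⟨u, hu, hlim⟩ := mem_closure_iff_seq_limit.1 hp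
    have h1 : Tendsto (fun n => (u n).1) atTop (𝓝 p.1) := (continuous_fst.tendsto p).comp hlim
    have h2 : Tendsto (fun n => (u n).2) atTop (𝓝 p.2) := (continuous_snd.tendsto p).comp hlim
    have h0 : 0 ≤ p.1 := ge_of_tendsto' h1 fun n => (hu n).1.le
    rcases h0.eq_or_lt with h0 | h0
    · refine Or.inl ⟨h0.symm, ge_of_tendsto' h2 fun n => ?_, le_of_tendsto' h2 fun n => ?_⟩
      · rw [(hu n).2.2]; exact Real.neg_one_le_sin _
      · rw [(hu n).2.2]; exact Real.sin_le_one _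
    · refine Or.inr ⟨h0, le_of_tendsto' h1 fun n => (hu n).2.1, tendsto_nhds_unique h2 ?_⟩
      have : Tendsto (fun n => Real.sin (1 / (u n).1)) atTop (𝓝 (Real.sin (1 / p.1))) :=
        (Real.continuous_sin.tendsto _).comp (tendsto_const_nhds.div h1 h0.ne')
      exact this.congr fun n => (hu n).2.2.symm
  · rintro (⟨h0, h1, h2⟩ | h)
    · have hpi := Real.pi_pos
      -- Solutions of sin v = p.2 tending to infinity. Shifting by at least one full period gives v
      -- n ≥ π/2, that is 1 / v n ≤ 2/π.
      set v : ℕ → ℝ := fun n => Real.arcsin p.2 + (n + 1 : ℕ) * (2 * Real.pi) with hv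
      have hvpos : ∀ n, Real.pi / 2 ≤ v n := by
        intro n
        have := Real.neg_pi_div_two_le_arcsin p.2
        simp only [hv]
        push_cast
        nlinarith [mul_nonneg (Nat.cast_nonneg (α := ℝ) n) hpi.le]
      have hvlim : Tendsto v atTop atTop := by
        refine tendsto_atTop_add_const_left _ _ ?_
        exact ((tendsto_natCast_atTop_atTop (R := ℝ)).comp (tendsto_add_atTop_nat 1)).atTop_mul_const
          (by positivity)
      have hsin : ∀ n, Real.sin (v n) = p.2 := fun n => by
        simp only [hv]
        rw [Real.sin_add_nat_mul_two_pi, Real.sin_arcsin h1 h2]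
      refine mem_closure_of_tendsto (f := fun n => (1 / v n, p.2)) (b := atTop) ?_
        (Eventually.of_forall fun n => ⟨?_, ?_, ?_⟩)
      · have : Tendsto (fun n => 1 / v n) atTop (𝓝 0) := tendsto_const_nhds.div_atTop hvlim
        have h3 := this.prodMk_nhds (tendsto_const_nhds (x := p.2))
        rwa [show ((0 : ℝ), p.2) = p from Prod.ext h0.symm rfl] at h3
      · have := hvpos n
        have : 0 < v n := by linarith
        positivity
      · have := hvpos n
        rw [div_le_div_iff₀ (by linarith) hpi]
        linarith
      · simp [hsin]
    · exact subset_closure h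

theorem mem_sineCurve_of_fst_pos {p : ℝ × ℝ} (hp : p ∈ closure sineCurve) (h : 0 < p.1) :
    p ∈ sineCurve := by
  rcases mem_closure_sineCurve.1 hp with h' | h'
  · exact absurd h'.1 h.ne'
  · exact h'

theorem closure_sineCurve_bounds {p : ℝ × ℝ} (hp : p ∈ closure sineCurve) :
    0 ≤ p.1 ∧ p.1 ≤ 2 / Real.pi ∧ -1 ≤ p.2 ∧ p.2 ≤ 1 := by
  have hpi := Real.pi_pos
  rcases mem_closure_sineCurve.1 hp with ⟨h0, h1, h2⟩ | ⟨h0, h1, h2⟩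
  · exact ⟨h0.ge, h0 ▸ by positivity, h1, h2⟩
  · exact ⟨h0.le, h1, h2 ▸ Real.neg_one_le_sin _, h2 ▸ Real.sin_le_one _⟩

instance : CompactSpace (closure sineCurve) := by
  rw [← isCompact_iff_compactSpace]
  refine (isCompact_Icc (a := ((0 : ℝ), (-1 : ℝ))) (b := (2 / Real.pi, 1))).of_isClosed_subset
    isClosed_closure fun p hp => ?_
  obtain ⟨h1, h2, h3, h4⟩ := closure_sineCurve_bounds hp
  exact ⟨⟨h1, h3⟩, ⟨h2, h4⟩⟩

/-- The lower end of the convergence segment. -/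
def sineLow : closure sineCurve :=
  ⟨(0, -1), mem_closure_sineCurve.2 (Or.inl (by norm_num))⟩

/-- The end point of the sine curve. -/
def sineEnd : closure sineCurve :=
  ⟨(2 / Real.pi, 1), mem_closure_sineCurve.2 (Or.inr ⟨by positivity, le_rfl, by simp⟩)⟩

theorem sineLow_coe : (sineLow : ℝ × ℝ) = (0, -1) := rfl
theorem sineEnd_coe : (sineEnd : ℝ × ℝ) = (2 / Real.pi, 1) := rfl

theorem sineEnd_fst_pos : 0 < (sineEnd : ℝ × ℝ).1 := by
  rw [sineEnd_coe]; positivity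

theorem eq_sineEnd {p : closure sineCurve} (h : p.1.1 = 2 / Real.pi) : p = sineEnd := by
  have h0 : 0 < p.1.1 := h ▸ by positivity
  have := (mem_sineCurve_of_fst_pos p.2 h0).2.2
  refine Subtype.ext (Prod.ext h ?_)
  rw [this, h, sineEnd_coe]
  simp

/-- The part of the sine curve over a path connected set of first coordinates. -/
theorem isPathConnected_sineCurve_inter {I : Set ℝ} (hI' : I ⊆ Ioc 0 (2 / Real.pi))
    (h : IsPathConnected I) : IsPathConnected {p : ℝ × ℝ | p ∈ sineCurve ∧ p.1 ∈ I} := by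
  have : {p : ℝ × ℝ | p ∈ sineCurve ∧ p.1 ∈ I} = (fun x : ℝ => (x, Real.sin (1 / x))) '' I := by
    ext p
    constructor
    · rintro ⟨hp, hpI⟩
      exact ⟨p.1, hpI, Prod.ext rfl hp.2.2.symm⟩
    · rintro ⟨x, hx, rfl⟩
      exact ⟨⟨(hI' hx).1, (hI' hx).2, rfl⟩, hx⟩
  rw [this]
  refine h.image' (continuousOn_id.prodMk (Real.continuous_sin.comp_continuousOn ?_))
  exact continuousOn_const.div continuousOn_id fun x hx => (hI' hx).1.ne'

theorem isPathConnected_sineCurve_Ioo {δ : ℝ} (h : 0 < δ) (h' : δ ≤ 2 / Real.pi) :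
    IsPathConnected {p : ℝ × ℝ | p ∈ sineCurve ∧ p.1 ∈ Ioo 0 δ} :=
  isPathConnected_sineCurve_inter (fun _ hx => ⟨hx.1, hx.2.le.trans h'⟩)
    ((convex_Ioo 0 δ).isPathConnected (nonempty_Ioo.2 h))

theorem isPathConnected_sineCurve : IsPathConnected sineCurve := by
  have h := isPathConnected_sineCurve_inter (I := Ioc 0 (2 / Real.pi)) le_rfl
    ((convex_Ioc _ _).isPathConnected (nonempty_Ioc.2 (by positivity)))
  convert h using 1
  ext p
  exact ⟨fun h => ⟨h, h.1, h.2.1⟩, fun h => h.1⟩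

theorem joined_of_fst_pos {p q : closure sineCurve} (hp : 0 < p.1.1) (hq : 0 < q.1.1) :
    Joined p q := by
  have h := isPathConnected_sineCurve.joinedIn _ (mem_sineCurve_of_fst_pos p.2 hp) _
    (mem_sineCurve_of_fst_pos q.2 hq)
  exact (h.mono subset_closure).joined_subtype

/-- The point of the convergence segment at height `t`. -/
def sineSeg (t : ℝ) : closure sineCurve :=
  ⟨(0, max (-1) (min 1 t)), mem_closure_sineCurve.2 (Or.inl (by simp))⟩

theorem continuous_sineSeg : Continuous sineSeg := by
  unfold sineSeg
  fun_prop

theorem sineSeg_coe {t : ℝ} (h1 : -1 ≤ t) (h2 : t ≤ 1) : (sineSeg t : ℝ × ℝ) = (0, t) := by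
  simp [sineSeg, h1, h2]

theorem sineSeg_snd {p : closure sineCurve} (hp : p.1.1 = 0) : sineSeg p.1.2 = p := by
  obtain ⟨-, -, h3, h4⟩ := closure_sineCurve_bounds p.2
  exact Subtype.ext ((sineSeg_coe h3 h4).trans (Prod.ext hp.symm rfl))

theorem isPathConnected_segment : IsPathConnected {p : closure sineCurve | p.1.1 = 0} := by
  have : {p : closure sineCurve | p.1.1 = 0} = sineSeg '' univ := by
    ext p
    simp only [image_univ, mem_range, mem_ofPred_eq]
    exact ⟨fun h => ⟨_, sineSeg_snd h⟩, by rintro ⟨t, rfl⟩; rfl⟩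
  rw [this]
  exact isPathConnected_univ.image continuous_sineSeg

theorem joined_of_fst_eq_zero {p q : closure sineCurve} (hp : p.1.1 = 0) (hq : q.1.1 = 0) :
    Joined p q :=
  (isPathConnected_segment.joinedIn p hp q hq).joined

/-- A connected part of the sine curve which accumulates on the convergence segment oscillates
fully. -/
theorem exists_oscillation {Q : Set (ℝ × ℝ)} (hQ : Q ⊆ sineCurve) (hc : IsPreconnected Q)
    {e : ℝ × ℝ} (he : e ∈ closure Q) (he1 : e.1 ≤ 0) :
    (∃ p ∈ Q, p.2 = 1) ∧ ∃ p ∈ Q, p.2 = -1 := by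
  have hpi := Real.pi_pos
  have hI : (Prod.fst '' Q).OrdConnected :=
    (hc.image _ continuous_fst.continuousOn).ordConnected
  obtain ⟨q, hq⟩ : Q.Nonempty := closure_nonempty_iff.1 ⟨e, he⟩
  have hq0 : 0 < q.1 := (hQ hq).1
  -- The first coordinates of Q form an interval with points arbitrarily close to 0, so Q contains
  -- the whole graph to the left of q.
  have key : ∀ x, 0 < x → x < q.1 → (x, Real.sin (1 / x)) ∈ Q := by
    intro x hx hxq
    obtain ⟨r, hr, hrQ⟩ := mem_closure_iff.1 he {p | p.1 < x} (isOpen_lt continuous_fst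
      continuous_const) (he1.trans_lt hx)
    obtain ⟨p, hp, hpx⟩ := hI.out ⟨r, hrQ, rfl⟩ ⟨q, hq, rfl⟩ ⟨le_of_lt hr, hxq.le⟩
    rwa [← hpx, ← (hQ hp).2.2]
  obtain ⟨n, hn⟩ := exists_nat_gt (1 / q.1)
  have h1 : ∀ a : ℝ, -Real.pi ≤ a → 
      0 < 1 / (a + (n + 1 : ℕ) * (2 * Real.pi)) ∧ 1 / (a + (n + 1 : ℕ) * (2 * Real.pi)) < q.1 := by
    intro a ha
    have h3 := Real.pi_gt_three
    have hn0 : (0 : ℝ) ≤ n := Nat.cast_nonneg n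
    have : (n : ℝ) < a + (n + 1 : ℕ) * (2 * Real.pi) := by
      push_cast
      nlinarith
    have hpos : 0 < a + (n + 1 : ℕ) * (2 * Real.pi) := by linarith
    refine ⟨by positivity, ?_⟩
    rw [one_div_lt hpos hq0]
    linarith
  refine ⟨⟨_, key _ (h1 (Real.pi / 2) (by linarith)).1 (h1 (Real.pi / 2) (by linarith)).2, ?_⟩,
    ⟨_, key _ (h1 (-(Real.pi / 2)) (by linarith)).1 (h1 (-(Real.pi / 2)) (by linarith)).2, ?_⟩⟩
  · simp only [one_div_one_div, Real.sin_add_nat_mul_two_pi, Real.sin_pi_div_two]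
  · simp only [one_div_one_div, Real.sin_add_nat_mul_two_pi, Real.sin_neg, Real.sin_pi_div_two]

/-- A continuous map from a connected set into the sine curve cannot be nearly constant if its
values approach the convergence segment. -/
theorem not_mapsTo_ball_sineCurve {Q : Set (ℝ × ℝ)} (hQ : Q ⊆ sineCurve) (hc : IsPreconnected Q)
    {e : ℝ × ℝ} (he : e ∈ closure Q) (he1 : e.1 ≤ 0) : ¬ Q ⊆ Metric.ball e 1 := by
  intro h
  obtain ⟨⟨p, hp, hp2⟩, ⟨q, hq, hq2⟩⟩ := exists_oscillation hQ hc he he1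
  have h1 := (max_lt_iff.1 (Metric.mem_ball.1 (h hp))).2
  have h2 := (max_lt_iff.1 (Metric.mem_ball.1 (h hq))).2
  rw [Real.dist_eq, abs_lt] at h1 h2
  linarith [h1.1, h1.2, h2.1, h2.2]

theorem isClosed_extendedSineCurve : IsClosed extendedSineCurve := by
  refine isClosed_closure.union ?_
  exact (isClosed_le continuous_const continuous_fst).inter
    ((isClosed_le continuous_fst continuous_const).inter
      (isClosed_eq continuous_snd continuous_const))

theorem extendedSineCurve_bounds {p : ℝ × ℝ} (hp : p ∈ extendedSineCurve) :
    -1 ≤ p.1 ∧ p.1 ≤ 2 / Real.pi ∧ -1 ≤ p.2 ∧ p.2 ≤ 1 := by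
  rcases hp with hp | ⟨h1, h2, h3⟩
  · obtain ⟨h1, h⟩ := closure_sineCurve_bounds hp
    exact ⟨by linarith, h⟩
  · exact ⟨h1, h2.trans (by positivity), by linarith, by linarith⟩

instance : CompactSpace extendedSineCurve := by
  rw [← isCompact_iff_compactSpace]
  refine (isCompact_Icc (a := ((-1 : ℝ), (-1 : ℝ))) (b := (2 / Real.pi, 1))).of_isClosed_subset
    isClosed_extendedSineCurve fun p hp => ?_
  obtain ⟨h1, h2, h3, h4⟩ := extendedSineCurve_bounds hp
  exact ⟨⟨h1, h3⟩, ⟨h2, h4⟩⟩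

/-- The inclusion of the closed sine curve into the extended one. -/
def sineIncl (p : closure sineCurve) : extendedSineCurve := ⟨p, Or.inl p.2⟩

theorem continuous_sineIncl : Continuous sineIncl := by
  unfold sineIncl
  fun_prop

theorem mem_sineCurve_of_extended {p : ℝ × ℝ} (hp : p ∈ extendedSineCurve) (h : 0 < p.1) :
    p ∈ sineCurve := by
  rcases hp with hp | hp
  · exact mem_sineCurve_of_fst_pos hp h
  · exact absurd hp.2.1 h.not_ge

/-- The sine curve cannot be reached from the remaining part of the extended sine curve. -/
theorem Joined.fst_nonpos {p q : extendedSineCurve} (h : Joined p q) (hp : p.1.1 ≤ 0) :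
    q.1.1 ≤ 0 := by
  obtain ⟨γ⟩ := h
  by_contra! hq
  set u : ℝ → ℝ × ℝ := fun t => (γ.extend t : ℝ × ℝ) with hu
  have huc : Continuous u := continuous_subtype_val.comp γ.continuous_extend
  set A : Set ℝ := {t | t ∈ Icc (0 : ℝ) 1 ∧ (u t).1 ≤ 0}
  have hAc : IsCompact A := (isCompact_Icc).inter_right
    (isClosed_le (continuous_fst.comp huc) continuous_const)
  have hA0 : (0 : ℝ) ∈ A := ⟨by simp, by simpa [hu] using hp⟩
  -- The last time at which the path is off the sine curve. Right after it the path runs in the sine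
  -- curve within a unit ball, which oscillation forbids.
  obtain ⟨a, haA, ha⟩ := hAc.exists_isGreatest ⟨0, hA0⟩
  have ha1 : a < 1 := by
    refine lt_of_le_of_ne haA.1.2 ?_
    rintro rfl
    have := haA.2
    simp only [hu, Path.extend_one] at this
    linarith
  obtain ⟨δ, hδ, hball⟩ := Metric.continuousAt_iff.1 (huc.continuousAt (x := a)) 1 one_pos
  set b := min 1 (a + δ / 2) with hb
  have hab : a < b := lt_min ha1 (by linarith)
  have hpos : ∀ t ∈ Ioo a b, 0 < (u t).1 := by
    intro t ht
    by_contra! h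
    have : t ∈ A := ⟨⟨haA.1.1.trans ht.1.le, (ht.2.trans_le (min_le_left _ _)).le⟩, h⟩
    exact absurd (ha this) ht.1.not_ge
  refine not_mapsTo_ball_sineCurve (Q := u '' Ioo a b) (e := u a) ?_
    (isPreconnected_Ioo.image _ huc.continuousOn) ?_ haA.2 ?_
  · rintro _ ⟨t, ht, rfl⟩
    exact mem_sineCurve_of_extended (γ.extend t).2 (hpos t ht)
  · refine image_closure_subset_closure_image huc ⟨a, ?_, rfl⟩
    rw [closure_Ioo hab.ne]
    exact left_mem_Icc.2 hab.le
  · rintro _ ⟨t, ht, rfl⟩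
    refine Metric.mem_ball.2 (hball ?_)
    have := ht.2.trans_le (min_le_right _ _)
    rw [Real.dist_eq, abs_lt]
    constructor <;> linarith [ht.1]

theorem Joined.fst_eq_zero {p q : closure sineCurve} (h : Joined p q) (hp : p.1.1 = 0) :
    q.1.1 = 0 :=
  le_antisymm (Joined.fst_nonpos (p := sineIncl p) (q := sineIncl q)
    (h.map continuous_sineIncl) hp.le) (closure_sineCurve_bounds q.2).1

/-! ### The folding map and its extension to the closed sine curve -/

/-- The folding map `cos θ ↦ cos 3θ`. -/
def foldMap (y : ℝ) : ℝ := 4 * y ^ 3 - 3 * y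

theorem foldMap_cos (θ : ℝ) : foldMap (Real.cos θ) = Real.cos (3 * θ) :=
  (Real.cos_three_mul θ).symm

theorem foldMap_neg (y : ℝ) : foldMap (-y) = -foldMap y := by
  unfold foldMap; ring

theorem continuous_foldMap : Continuous foldMap := by
  unfold foldMap; fun_prop

theorem foldMap_mem {y : ℝ} (h1 : -1 ≤ y) (h2 : y ≤ 1) : -1 ≤ foldMap y ∧ foldMap y ≤ 1 := by
  rw [← Real.cos_arccos h1 h2, foldMap_cos]
  exact ⟨Real.neg_one_le_cos _, Real.cos_le_one _⟩

theorem iterate_foldMap_cos (k : ℕ) (θ : ℝ) : foldMap^[k] (Real.cos θ) = Real.cos (3 ^ k * θ) := by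
  induction k with
  | zero => simp
  | succ k ih => rw [Function.iterate_succ_apply', ih, foldMap_cos, pow_succ']; ring_nf

/-- For y = cos θ the k-th iterate multiplies θ by 3^k, so it equals -1 at the odd multiples of
π/3^k. One of these is within π/3^k of θ, and cosine is 1-Lipschitz. -/
theorem exists_iterate_foldMap_eq_neg_one {y : ℝ} (h1 : -1 ≤ y) (h2 : y ≤ 1) (k : ℕ) :
    ∃ z, -1 ≤ z ∧ z ≤ 1 ∧ foldMap^[k] z = -1 ∧ |z - y| ≤ Real.pi / 3 ^ k := by
  have hpi := Real.pi_pos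
  set θ := Real.arccos y
  set m : ℤ := ⌊3 ^ k * θ / (2 * Real.pi)⌋
  refine ⟨Real.cos ((2 * m + 1) * Real.pi / 3 ^ k), Real.neg_one_le_cos _, Real.cos_le_one _, ?_, ?_⟩
  · rw [iterate_foldMap_cos, show (3 : ℝ) ^ k * ((2 * m + 1) * Real.pi / 3 ^ k)
      = Real.pi + m * (2 * Real.pi) by field_simp; ring, Real.cos_add_int_mul_two_pi, Real.cos_pi]
  · rw [← Real.cos_arccos h1 h2]
    refine (Real.abs_cos_sub_cos_le _ _).trans ?_
    have h3 : (0 : ℝ) < 3 ^ k := by positivity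
    have e : (2 * m + 1) * Real.pi / 3 ^ k - θ = ((2 * m + 1) * Real.pi - 3 ^ k * θ) / 3 ^ k := by
      field_simp
    have ha := Int.floor_le (3 ^ k * θ / (2 * Real.pi))
    have hb := Int.lt_floor_add_one (3 ^ k * θ / (2 * Real.pi))
    rw [le_div_iff₀ (by positivity)] at ha
    rw [div_lt_iff₀ (by positivity)] at hb
    rw [e, abs_div, abs_of_pos h3]
    gcongr
    rw [abs_le]
    constructor <;> linarith

/-- The self-map of the closed sine curve which is the folding map on the convergence segment. -/
def sineFold (p : closure sineCurve) : closure sineCurve :=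
  ⟨(p.1.1 / (3 - Real.pi * p.1.1), foldMap p.1.2), by
    have hpi := Real.pi_pos
    rcases mem_closure_sineCurve.1 p.2 with ⟨h0, h1, h2⟩ | ⟨h0, h1, h2⟩
    · exact mem_closure_sineCurve.2 (Or.inl ⟨by simp [h0], foldMap_mem h1 h2⟩)
    · rw [le_div_iff₀ hpi] at h1
      have h3 : 0 < 3 - Real.pi * p.1.1 := by linarith
      refine mem_closure_sineCurve.2 (Or.inr ⟨by positivity, ?_, ?_⟩)
      · rw [div_le_div_iff₀ h3 hpi]
        linarith
      -- In the variable t = 1/x the map is t ↦ 3t - π, and sin (3t - π) = -sin 3t is the fold of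
      -- sin t.
      · rw [show 1 / (p.1.1 / (3 - Real.pi * p.1.1)) = 3 * (1 / p.1.1) - Real.pi by
          field_simp, Real.sin_sub_pi, Real.sin_three_mul, ← h2, foldMap]
        ring⟩

theorem sineFold_den_pos (p : closure sineCurve) : 0 < 3 - Real.pi * p.1.1 := by
  have := (closure_sineCurve_bounds p.2).2.1
  rw [le_div_iff₀ Real.pi_pos] at this
  linarith

theorem continuous_sineFold : Continuous sineFold := by
  refine Continuous.subtype_mk (Continuous.prodMk ?_ (continuous_foldMap.comp (by fun_prop))) _
  exact Continuous.div (by fun_prop) (by fun_prop) fun p => (sineFold_den_pos p).ne'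

theorem sineFold_fst_eq_zero {p : closure sineCurve} : (sineFold p).1.1 = 0 ↔ p.1.1 = 0 := by
  simp [sineFold, (sineFold_den_pos p).ne']

theorem sineFold_sineLow : sineFold sineLow = sineLow := by
  apply Subtype.ext
  simp [sineFold, sineLow_coe, foldMap]
  norm_num

theorem sineFold_sineEnd : sineFold sineEnd = sineEnd := by
  apply Subtype.ext
  simp only [sineFold, sineEnd_coe, foldMap]
  rw [mul_div_cancel₀ _ Real.pi_ne_zero]
  norm_num

instance : ConnectedSpace (closure sineCurve) :=
  Subtype.connectedSpace isPathConnected_sineCurve.isConnected.closure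

/-! ### The curves converging to the arc -/

/-- The horizontal scale of the `i`-th curve of the chain, counting from `0`. -/
def chainScale (i : ℕ) : ℝ := 1 / 2 ^ (i + 1)

theorem chainScale_pos (i : ℕ) : 0 < chainScale i := by unfold chainScale; positivity

theorem chainScale_succ (i : ℕ) : chainScale (i + 1) = chainScale i / 2 := by
  unfold chainScale; field_simp; ring

theorem chainScale_antitone : Antitone chainScale := by
  refine antitone_nat_of_succ_le fun i => ?_
  rw [chainScale_succ]
  linarith [chainScale_pos i]

theorem tendsto_chainScale : Tendsto chainScale atTop (𝓝 0) := by
  have h := (tendsto_pow_atTop_nhds_zero_of_lt_one (r := (1 / 2 : ℝ)) (by norm_num)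
    (by norm_num)).comp (tendsto_add_atTop_nat 1)
  refine h.congr fun i => ?_
  simp [chainScale]

theorem chainMap_succ_fst (i : ℕ) (p : ℝ × ℝ) :
    (chainMap (i + 1) p).1 = -2 - chainScale i * (1 + Real.pi / 2 * p.1) := by
  simp only [chainMap, chainScale]; ring

theorem chainMap_succ_snd (i : ℕ) (p : ℝ × ℝ) :
    (chainMap (i + 1) p).2 = (-1) ^ i * p.2 := by
  simp only [chainMap]; ring

theorem continuous_chainMap (i : ℕ) : Continuous (chainMap i) := by
  unfold chainMap; fun_prop

/-- The `i`-th curve of the chain, counting from `0`. -/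
def chainCurve (i : ℕ) (p : closure sineCurve) : sineCurvesToArc :=
  ⟨chainMap (i + 1) p, Or.inr (mem_iUnion₂.2 ⟨i + 1, by omega, p, p.2, rfl⟩)⟩

theorem continuous_chainCurve (i : ℕ) : Continuous (chainCurve i) :=
  ((continuous_chainMap _).comp continuous_subtype_val).subtype_mk _

theorem chainCurve_fst (i : ℕ) (p : closure sineCurve) :
    (chainCurve i p).1.1 = -2 - chainScale i * (1 + Real.pi / 2 * p.1.1) :=
  chainMap_succ_fst i p

theorem chainCurve_snd (i : ℕ) (p : closure sineCurve) :
    (chainCurve i p).1.2 = (-1) ^ i * p.1.2 :=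
  chainMap_succ_snd i p

theorem one_add_mem_Icc (p : closure sineCurve) :
    1 ≤ 1 + Real.pi / 2 * p.1.1 ∧ 1 + Real.pi / 2 * p.1.1 ≤ 2 := by
  obtain ⟨h1, h2, -⟩ := closure_sineCurve_bounds p.2
  rw [le_div_iff₀ Real.pi_pos] at h2
  have := mul_nonneg Real.pi_pos.le h1
  constructor <;> linarith

theorem chainCurve_fst_bounds (i : ℕ) (p : closure sineCurve) :
    -2 - 2 * chainScale i ≤ (chainCurve i p).1.1 ∧ (chainCurve i p).1.1 ≤ -2 - chainScale i := by
  rw [chainCurve_fst]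
  obtain ⟨h1, h2⟩ := one_add_mem_Icc p
  have := chainScale_pos i
  constructor <;> nlinarith

theorem chainCurve_fst_lt (i : ℕ) (p : closure sineCurve) : (chainCurve i p).1.1 < -2 := by
  linarith [(chainCurve_fst_bounds i p).2, chainScale_pos i]

theorem chainCurve_injective (i : ℕ) : Function.Injective (chainCurve i) := by
  intro p q h
  have h1 := congrArg (fun w : sineCurvesToArc => w.1.1) h
  have h2 := congrArg (fun w : sineCurvesToArc => w.1.2) h
  simp only [chainCurve_fst, chainCurve_snd] at h1 h2
  refine Subtype.ext (Prod.ext ?_ (mul_left_cancel₀ (pow_ne_zero _ (by norm_num)) h2))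
  have h3 := mul_left_cancel₀ (chainScale_pos i).ne' (sub_right_injective h1)
  have := Real.pi_pos
  exact mul_left_cancel₀ (by positivity : Real.pi / 2 ≠ 0) (by linarith)

theorem chainCurve_low (i : ℕ) : chainCurve i sineLow = chainCurve (i + 1) sineEnd := by
  refine Subtype.ext (Prod.ext ?_ ?_)
  · rw [chainCurve_fst, chainCurve_fst, sineLow_coe, sineEnd_coe, chainScale_succ]
    have := Real.pi_pos
    field_simp
    ring
  · rw [chainCurve_snd, chainCurve_snd, sineLow_coe, sineEnd_coe]
    simp [pow_succ]

/-- The i-th curve lies over the interval from -2 - 2s to -2 - s with s = `chainScale i`, and s is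
halved at each step. Hence only consecutive intervals meet, in one point, over which the later curve
has only its end point. -/
theorem eq_of_chainCurve_eq {i j : ℕ} {p q : closure sineCurve} (hij : i < j)
    (h : chainCurve i p = chainCurve j q) : j = i + 1 ∧ p = sineLow ∧ q = sineEnd := by
  have h1 := congrArg (fun w : sineCurvesToArc => w.1.1) h
  have h2 := congrArg (fun w : sineCurvesToArc => w.1.2) h
  simp only [chainCurve_fst, chainCurve_snd] at h1 h2
  obtain ⟨hp, -⟩ := one_add_mem_Icc p
  obtain ⟨-, hq⟩ := one_add_mem_Icc q
  have hi := chainScale_pos i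
  have hj := chainScale_pos j
  have hs : chainScale j ≤ chainScale i / 2 := by
    rw [← chainScale_succ]; exact chainScale_antitone hij
  have hji : chainScale j = chainScale i / 2 := by nlinarith
  have hpi := Real.pi_pos
  have hp1 : p.1.1 = 0 := by
    have : Real.pi / 2 * p.1.1 = 0 := by nlinarith
    simpa [hpi.ne'] using this
  have hq1 : q = sineEnd := by
    apply eq_sineEnd
    have : Real.pi / 2 * q.1.1 = 1 := by nlinarith
    field_simp
    linarith
  have hj' : j = i + 1 := by
    by_contra hne
    have h3 := chainScale_antitone (show i + 1 + 1 ≤ j by omega)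
    rw [chainScale_succ, chainScale_succ] at h3
    linarith
  refine ⟨hj', Subtype.ext (Prod.ext hp1 ?_), hq1⟩
  subst hj'
  rw [hq1, sineEnd_coe, pow_succ, mul_assoc] at h2
  have h3 := mul_left_cancel₀ (pow_ne_zero i (by norm_num : (-1 : ℝ) ≠ 0)) h2
  rw [h3, sineLow_coe]
  norm_num

theorem sineCurvesToArc_cases (w : sineCurvesToArc) :
    (w.1.1 = -2 ∧ -1 ≤ w.1.2 ∧ w.1.2 ≤ 1) ∨ ∃ i p, chainCurve i p = w := by
  obtain ⟨w, hw | hw⟩ := w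
  · exact Or.inl hw
  · obtain ⟨i, hi, p, hp, rfl⟩ := mem_iUnion₂.1 hw
    obtain ⟨i, rfl⟩ : ∃ j, i = j + 1 := ⟨i - 1, by omega⟩
    exact Or.inr ⟨i, ⟨p, hp⟩, rfl⟩

theorem sineCurvesToArc_bounds (w : sineCurvesToArc) :
    -3 ≤ w.1.1 ∧ w.1.1 ≤ -2 ∧ -1 ≤ w.1.2 ∧ w.1.2 ≤ 1 := by
  rcases sineCurvesToArc_cases w with ⟨h, h'⟩ | ⟨i, p, rfl⟩
  · exact ⟨by linarith, h.le, h'⟩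
  · obtain ⟨h1, h2⟩ := chainCurve_fst_bounds i p
    have hi := chainScale_pos i
    have h0 := chainScale_antitone (Nat.zero_le i)
    have h00 : chainScale 0 = 1 / 2 := by norm_num [chainScale]
    obtain ⟨-, -, h3, h4⟩ := closure_sineCurve_bounds p.2
    refine ⟨by linarith, by linarith, ?_⟩
    rw [chainCurve_snd]
    rcases neg_one_pow_eq_or ℝ i with h | h <;> rw [h] <;> constructor <;> linarith

theorem exists_scale_lt {x : ℝ} (hx : x < -2) : ∃ N, x < -2 - 2 * chainScale N := by
  have : Tendsto (fun n => -2 - 2 * chainScale n) atTop (𝓝 (-2 - 2 * 0)) :=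
    tendsto_const_nhds.sub (tendsto_chainScale.const_mul 2)
  exact (this.eventually_const_lt (by linarith)).exists

theorem exists_chainCurve_lt {w : sineCurvesToArc} {N : ℕ} (h : w.1.1 < -2 - 2 * chainScale N) :
    ∃ i < N, ∃ p, chainCurve i p = w := by
  rcases sineCurvesToArc_cases w with ⟨h', -⟩ | ⟨i, p, rfl⟩
  · linarith [chainScale_pos N]
  · refine ⟨i, ?_, p, rfl⟩
    by_contra! hi
    linarith [(chainCurve_fst_bounds i p).1, chainScale_antitone hi]

theorem exists_chainCurve_ge {w : sineCurvesToArc} {N : ℕ} (h : -2 - chainScale N < w.1.1) :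
    w.1.1 = -2 ∨ ∃ i, N ≤ i ∧ ∃ p, chainCurve i p = w := by
  rcases sineCurvesToArc_cases w with ⟨h', -⟩ | ⟨i, p, rfl⟩
  · exact Or.inl h'
  · refine Or.inr ⟨i, ?_, p, rfl⟩
    by_contra! hi
    linarith [(chainCurve_fst_bounds i p).2, chainScale_antitone hi.le]

theorem eventually_chainCurve_ge {w : sineCurvesToArc} (hw : w.1.1 = -2) (N : ℕ) :
    ∀ᶠ v in 𝓝 w, v.1.1 = -2 ∨ ∃ i, N ≤ i ∧ ∃ p, chainCurve i p = v := by
  have h : ∀ᶠ v : sineCurvesToArc in 𝓝 w, -2 - chainScale N < v.1.1 :=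
    (isOpen_lt continuous_const (by fun_prop : Continuous fun v : sineCurvesToArc => v.1.1)).mem_nhds
      (show -2 - chainScale N < w.1.1 by linarith [chainScale_pos N])
  exact h.mono fun v => exists_chainCurve_ge

theorem isClosed_sineCurvesToArc : IsClosed sineCurvesToArc := by
  refine isClosed_of_closure_subset fun w hw => ?_
  have hb : w ∈ Icc (-3 : ℝ) (-2) ×ˢ Icc (-1 : ℝ) 1 := by
    refine closure_minimal (fun v hv => ?_) (isClosed_Icc.prod isClosed_Icc) hw
    obtain ⟨h1, h2, h3⟩ := sineCurvesToArc_bounds ⟨v, hv⟩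
    exact ⟨⟨h1, h2⟩, h3⟩
  rcases hb.1.2.eq_or_lt with h | h
  · exact Or.inl ⟨h, hb.2.1, hb.2.2⟩
  · obtain ⟨N, hN⟩ := exists_scale_lt h
    have hU : IsOpen {v : ℝ × ℝ | v.1 < -2 - 2 * chainScale N} :=
      isOpen_lt continuous_fst continuous_const
    have hcl : IsClosed (⋃ i ∈ Finset.range N, chainMap (i + 1) '' closure sineCurve) := by
      refine isClosed_biUnion_finset fun i _ => ?_
      exact ((isCompact_iff_compactSpace.2 inferInstance).image
        (continuous_chainMap _)).isClosed
    have hw' := closure_minimal (fun v hv => ?_) hcl (hU.inter_closure ⟨hN, hw⟩)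
    · obtain ⟨i, -, hi⟩ := mem_iUnion₂.1 hw'
      exact Or.inr (mem_iUnion₂.2 ⟨i + 1, by omega, hi⟩)
    · obtain ⟨i, hi, p, hp⟩ := exists_chainCurve_lt (w := ⟨v, hv.2⟩) hv.1
      exact mem_iUnion₂.2 ⟨i, Finset.mem_range.2 hi, p, p.2, congrArg Subtype.val hp⟩

instance : CompactSpace sineCurvesToArc := by
  rw [← isCompact_iff_compactSpace]
  refine (isCompact_Icc (a := ((-3 : ℝ), (-1 : ℝ))) (b := (-2, 1))).of_isClosed_subset
    isClosed_sineCurvesToArc fun p hp => ?_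
  obtain ⟨h1, h2, h3, h4⟩ := sineCurvesToArc_bounds ⟨p, hp⟩
  exact ⟨⟨h1, h3⟩, ⟨h2, h4⟩⟩

theorem isClosedEmbedding_chainCurve (i : ℕ) : IsClosedEmbedding (chainCurve i) :=
  (continuous_chainCurve i).isClosedEmbedding (chainCurve_injective i)

/-! ### Maps on W glued from maps on the curves -/

open Classical in
/-- The map on `sineCurvesToArc` given by `h i` on the `i`-th curve and constant on the arc. -/
def chainGlue {Y : Type*} (h : ℕ → closure sineCurve → Y) (c : Y) (w : sineCurvesToArc) : Y :=
  if hw : ∃ i p, chainCurve i p = w then h hw.choose hw.choose_spec.choose else c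

theorem chainGlue_arc {Y : Type*} (h : ℕ → closure sineCurve → Y) (c : Y) {w : sineCurvesToArc}
    (hw : w.1.1 = -2) : chainGlue h c w = c := by
  rw [chainGlue, dif_neg]
  rintro ⟨i, p, rfl⟩
  exact (chainCurve_fst_lt i p).ne hw

theorem eq_of_chainCurve_eq_of_compat {Y : Type*} {h : ℕ → closure sineCurve → Y}
    (hc : ∀ i, h i sineLow = h (i + 1) sineEnd) {i j : ℕ} {p q : closure sineCurve}
    (hq : chainCurve j q = chainCurve i p) : h j q = h i p := by
  rcases lt_trichotomy j i with hij | rfl | hij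
  · obtain ⟨rfl, rfl, rfl⟩ := eq_of_chainCurve_eq hij hq
    exact hc j
  · rw [chainCurve_injective j hq]
  · obtain ⟨rfl, rfl, rfl⟩ := eq_of_chainCurve_eq hij hq.symm
    exact (hc i).symm

theorem chainGlue_chainCurve {Y : Type*} {h : ℕ → closure sineCurve → Y} (c : Y)
    (hc : ∀ i, h i sineLow = h (i + 1) sineEnd) (i : ℕ) (p : closure sineCurve) :
    chainGlue h c (chainCurve i p) = h i p := by
  have hw : ∃ j q, chainCurve j q = chainCurve i p := ⟨i, p, rfl⟩
  rw [chainGlue, dif_pos hw]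
  exact eq_of_chainCurve_eq_of_compat hc hw.choose_spec.choose_spec

/-- Near a point off the arc only finitely many closed curves occur, so continuity can be checked on
each of them. Near the arc only curves of large index occur, where `e` forces values close to `c`.
-/
theorem continuous_chainGlue {Y : Type*} [PseudoMetricSpace Y] {h : ℕ → closure sineCurve → Y}
    {c : Y} (hc : ∀ i, h i sineLow = h (i + 1) sineEnd) (hcont : ∀ i, Continuous (h i))
    {e : ℕ → ℝ} (he : Tendsto e atTop (𝓝 0)) (hdist : ∀ i p, dist (h i p) c ≤ e i) :
    Continuous (chainGlue h c) := by
  rw [continuous_iff_continuousAt]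
  intro w
  rcases (sineCurvesToArc_bounds w).2.1.eq_or_lt with hw | hw
  · rw [Metric.continuousAt_iff']
    intro ε hε
    obtain ⟨N, hN⟩ := eventually_atTop.1 (he.eventually_lt_const hε)
    filter_upwards [eventually_chainCurve_ge hw N] with v hv
    rw [chainGlue_arc h c hw]
    rcases hv with hv | ⟨i, hi, p, rfl⟩
    · rwa [chainGlue_arc h c hv, dist_self]
    · rw [chainGlue_chainCurve c hc]
      exact (hdist i p).trans_lt (hN i hi)
  · obtain ⟨N, hN⟩ := exists_scale_lt hw
    have hU : {v : sineCurvesToArc | v.1.1 < -2 - 2 * chainScale N} ∈ 𝓝 w :=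
      (isOpen_lt (by fun_prop) continuous_const).mem_nhds hN
    have hon : ContinuousOn (chainGlue h c) (⋃ i : Fin N, range (chainCurve i)) := by
      refine LocallyFinite.continuousOn_iUnion (locallyFinite_of_finite _)
        (fun i => (isClosedEmbedding_chainCurve i).isClosed_range) fun i => ?_
      rw [continuousOn_iff_continuous_domRestrict]
      have : (range (chainCurve i)).domRestrict (chainGlue h c) =
          h i ∘ (isClosedEmbedding_chainCurve i).isEmbedding.toHomeomorph.symm := by
        ext v
        obtain ⟨p, rfl⟩ := (isClosedEmbedding_chainCurve i).isEmbedding.toHomeomorph.surjective v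
        rw [Function.comp_apply, Homeomorph.symm_apply_apply]
        exact chainGlue_chainCurve c hc i p
      rw [this]
      exact (hcont i).comp (Homeomorph.continuous _)
    refine hon.continuousAt (mem_of_superset hU fun v hv => ?_)
    obtain ⟨i, hi, p, rfl⟩ := exists_chainCurve_lt hv
    exact mem_iUnion.2 ⟨⟨i, hi⟩, p, rfl⟩

/-- The retraction of `sineCurvesToArc` to its `n`-th curve, read in the closed sine curve. -/
def chainRetract (n : ℕ) : sineCurvesToArc → closure sineCurve :=
  chainGlue (fun i p => if i < n then sineEnd else if i = n then p else sineLow) sineLow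

theorem chainRetract_compat (n i : ℕ) :
    (fun i p => if i < n then sineEnd else if i = n then p else sineLow) i sineLow =
    (fun i p => if i < n then sineEnd else if i = n then p else sineLow) (i + 1) sineEnd := by
  simp only
  split_ifs <;> first | rfl | omega

theorem continuous_chainRetract (n : ℕ) : Continuous (chainRetract n) := by
  refine continuous_chainGlue (chainRetract_compat n) (fun i => ?_)
    (e := fun i => if i ≤ n then Metric.diam (univ : Set (closure sineCurve)) else 0)
    (tendsto_const_nhds.congr' ?_) fun i p => ?_
  · split_ifs <;> fun_prop
  · filter_upwards [eventually_gt_atTop n] with i hi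
    rw [if_neg (by omega)]
  · split_ifs <;> first | omega | simp |
      exact Metric.dist_le_diam_of_mem isCompact_univ.isBounded (mem_univ _) (mem_univ _)

theorem chainRetract_of_lt {n i : ℕ} (h : i < n) (p : closure sineCurve) :
    chainRetract n (chainCurve i p) = sineEnd := by
  rw [chainRetract, chainGlue_chainCurve _ (chainRetract_compat n), if_pos h]

theorem chainRetract_self (n : ℕ) (p : closure sineCurve) :
    chainRetract n (chainCurve n p) = p := by
  rw [chainRetract, chainGlue_chainCurve _ (chainRetract_compat n), if_neg (lt_irrefl n),
    if_pos rfl]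

theorem chainRetract_of_gt {n i : ℕ} (h : n < i) (p : closure sineCurve) :
    chainRetract n (chainCurve i p) = sineLow := by
  rw [chainRetract, chainGlue_chainCurve _ (chainRetract_compat n), if_neg (by omega),
    if_neg (by omega)]

theorem chainRetract_arc (n : ℕ) {w : sineCurvesToArc} (h : w.1.1 = -2) :
    chainRetract n w = sineLow :=
  chainGlue_arc _ _ h

/-- The first coordinate of the map which lays the curves of the chain along the successive
monotone pieces of the sine curve. -/
def lapCoord : sineCurvesToArc → ℝ :=
  chainGlue (fun i p => 1 / (Real.pi / 2 + i * Real.pi + Real.arccos p.1.2)) 0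

theorem lapCoord_compat (i : ℕ) :
    (fun (i : ℕ) (p : closure sineCurve) => 1 / (Real.pi / 2 + i * Real.pi + Real.arccos p.1.2)) i
      sineLow = (fun (i : ℕ) (p : closure sineCurve) =>
        1 / (Real.pi / 2 + i * Real.pi + Real.arccos p.1.2)) (i + 1) sineEnd := by
  simp only [sineLow_coe, sineEnd_coe, Real.arccos_neg_one, Real.arccos_one]
  push_cast
  ring_nf

theorem lapCoord_den_pos (i : ℕ) (y : ℝ) : 0 < Real.pi / 2 + i * Real.pi + Real.arccos y := by
  have := Real.pi_pos
  have := Real.arccos_nonneg y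
  positivity

theorem lapCoord_chainCurve (i : ℕ) (p : closure sineCurve) :
    lapCoord (chainCurve i p) = 1 / (Real.pi / 2 + i * Real.pi + Real.arccos p.1.2) :=
  chainGlue_chainCurve (0 : ℝ) lapCoord_compat i p

theorem lapCoord_arc {w : sineCurvesToArc} (h : w.1.1 = -2) : lapCoord w = 0 :=
  chainGlue_arc _ _ h

theorem continuous_lapCoord : Continuous lapCoord := by
  have hpi := Real.pi_gt_three
  refine continuous_chainGlue lapCoord_compat (fun i => ?_)
    (tendsto_one_div_add_atTop_nhds_zero_nat (𝕜 := ℝ)) fun i p => ?_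
  · exact continuous_const.div (by fun_prop) fun p => (lapCoord_den_pos i _).ne'
  · have h := lapCoord_den_pos i p.1.2
    rw [Real.dist_0_eq_abs, abs_of_pos (by positivity)]
    refine one_div_le_one_div_of_le (by positivity) ?_
    have := Real.arccos_nonneg p.1.2
    nlinarith [Nat.cast_nonneg (α := ℝ) i]

theorem lap_mem (w : sineCurvesToArc) : (lapCoord w, w.1.2) ∈ closure sineCurve := by
  rw [mem_closure_sineCurve]
  rcases sineCurvesToArc_cases w with ⟨h, h'⟩ | ⟨i, p, rfl⟩
  · exact Or.inl ⟨lapCoord_arc h, h'⟩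
  · have h := lapCoord_den_pos i p.1.2
    obtain ⟨-, -, h1, h2⟩ := closure_sineCurve_bounds p.2
    rw [lapCoord_chainCurve]
    refine Or.inr ⟨by positivity, ?_, ?_⟩
    · rw [div_le_div_iff₀ h Real.pi_pos]
      have := Real.arccos_nonneg p.1.2
      have := mul_nonneg (Nat.cast_nonneg (α := ℝ) i) Real.pi_pos.le
      linarith
    · simp only [one_div_one_div, chainCurve_snd]
      -- The summand π/2 turns sine into cosine, and iπ contributes the sign (-1)^i with which the
      -- i-th curve is reflected.
      rw [show Real.pi / 2 + i * Real.pi + Real.arccos p.1.2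
        = (Real.arccos p.1.2 + i * Real.pi) + Real.pi / 2 by ring, Real.sin_add_pi_div_two,
        Real.cos_add_nat_mul_pi, Real.cos_arccos h1 h2]

/-- The map from `sineCurvesToArc` to the closed sine curve which preserves heights. -/
def chainLap (w : sineCurvesToArc) : closure sineCurve := ⟨(lapCoord w, w.1.2), lap_mem w⟩

theorem continuous_chainLap : Continuous chainLap := by
  have := continuous_lapCoord
  unfold chainLap
  fun_prop

theorem chainLap_fst_eq_zero {w : sineCurvesToArc} : (chainLap w).1.1 = 0 ↔ w.1.1 = -2 := by
  constructor
  · intro h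
    rcases sineCurvesToArc_cases w with h' | ⟨i, p, rfl⟩
    · exact h'.1
    · have h' := lapCoord_den_pos i p.1.2
      have h'' : lapCoord (chainCurve i p) = 0 := h
      rw [lapCoord_chainCurve] at h''
      exact absurd h'' (by positivity)
  · exact lapCoord_arc

/-- The first coordinate of `chainFold`. -/
def chainFoldCoord : sineCurvesToArc → ℝ :=
  chainGlue (fun i p => (chainCurve i (sineFold p)).1.1) (-2)

theorem chainFoldCoord_compat (i : ℕ) :
    (fun (i : ℕ) (p : closure sineCurve) => (chainCurve i (sineFold p)).1.1) i sineLow =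
    (fun (i : ℕ) (p : closure sineCurve) => (chainCurve i (sineFold p)).1.1) (i + 1) sineEnd := by
  simp only [sineFold_sineLow, sineFold_sineEnd, chainCurve_low]

theorem chainFoldCoord_arc {w : sineCurvesToArc} (h : w.1.1 = -2) : chainFoldCoord w = -2 :=
  chainGlue_arc _ _ h

theorem chainFoldCoord_chainCurve (i : ℕ) (p : closure sineCurve) :
    chainFoldCoord (chainCurve i p) = (chainCurve i (sineFold p)).1.1 :=
  chainGlue_chainCurve (-2 : ℝ) chainFoldCoord_compat i p

theorem continuous_chainFoldCoord : Continuous chainFoldCoord := by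
  refine continuous_chainGlue chainFoldCoord_compat (fun i => ?_)
    (by simpa using tendsto_chainScale.const_mul 2) fun i p => ?_
  · exact continuous_fst.comp (continuous_subtype_val.comp
      ((continuous_chainCurve i).comp continuous_sineFold))
  · obtain ⟨h1, h2⟩ := chainCurve_fst_bounds i (sineFold p)
    have := chainScale_pos i
    rw [Real.dist_eq, abs_le]
    constructor <;> linarith

/-- The folding map is odd, so it commutes with the reflections (-1)^i; one height formula then
serves all curves and the arc. -/
theorem chainFold_aux (i : ℕ) (p : closure sineCurve) :
    (chainFoldCoord (chainCurve i p), foldMap (chainCurve i p).1.2) =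
      (chainCurve i (sineFold p)).1 := by
  refine Prod.ext (chainFoldCoord_chainCurve i p) ?_
  simp only [chainCurve_snd, sineFold]
  rcases neg_one_pow_eq_or ℝ i with h | h <;> simp [h, foldMap_neg]

theorem chainFold_mem (w : sineCurvesToArc) :
    (chainFoldCoord w, foldMap w.1.2) ∈ sineCurvesToArc := by
  rcases sineCurvesToArc_cases w with ⟨h, h1, h2⟩ | ⟨i, p, rfl⟩
  · exact Or.inl ⟨chainFoldCoord_arc h, foldMap_mem h1 h2⟩
  · rw [chainFold_aux]
    exact Subtype.property _

/-- The self-map of `sineCurvesToArc` which is the folding map on the arc. -/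
def chainFold (w : sineCurvesToArc) : sineCurvesToArc :=
  ⟨(chainFoldCoord w, foldMap w.1.2), chainFold_mem w⟩

theorem continuous_chainFold : Continuous chainFold := by
  have := continuous_chainFoldCoord
  have := continuous_foldMap
  unfold chainFold
  fun_prop

theorem chainFold_fst {w : sineCurvesToArc} : (chainFold w).1.1 = -2 ↔ w.1.1 = -2 := by
  constructor
  · intro h
    rcases sineCurvesToArc_cases w with h' | ⟨i, p, rfl⟩
    · exact h'.1
    · have h' : (chainFoldCoord (chainCurve i p), foldMap (chainCurve i p).1.2).1 = -2 := h
      rw [chainFold_aux] at h'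
      exact absurd h' (chainCurve_fst_lt _ _).ne
  · exact chainFoldCoord_arc

/-- The union of the curves of the chain from the `n`-th on is connected. -/
theorem isPreconnected_iUnion_chainCurve (n : ℕ) :
    IsPreconnected (⋃ i : ℕ, range (chainCurve (n + i))) := by
  refine IsPreconnected.iUnion_of_chain (fun i => isPreconnected_range (continuous_chainCurve _))
    fun i => ⟨chainCurve (n + i) sineLow, mem_range_self _, ?_⟩
  rw [Nat.succ_eq_succ, chainCurve_low]
  exact mem_range_self _

theorem mem_closure_iUnion_chainCurve (n : ℕ) {w : sineCurvesToArc} (hw : w.1.1 = -2) :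
    w ∈ closure (⋃ i : ℕ, range (chainCurve (n + i))) := by
  have h1 : ∀ i, |(-1) ^ i * w.1.2| ≤ 1 := fun i => by
    rw [abs_mul, abs_pow, abs_neg, abs_one, one_pow, one_mul, abs_le]
    exact (sineCurvesToArc_bounds w).2.2
  -- The sign in the argument of `sineSeg` cancels the reflection of the curve, so all approximating
  -- points have the height of `w`.
  refine mem_closure_of_tendsto (f := fun i => chainCurve (n + i)
    (sineSeg ((-1) ^ (n + i) * w.1.2))) (b := atTop) ?_
    (Eventually.of_forall fun i => mem_iUnion.2 ⟨i, mem_range_self _⟩)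
  rw [tendsto_subtype_rng]
  have h2 : ∀ i, (chainCurve (n + i) (sineSeg ((-1) ^ (n + i) * w.1.2))).1 =
      (-2 - chainScale (n + i), w.1.2) := by
    intro i
    obtain ⟨ha, hb⟩ := abs_le.1 (h1 (n + i))
    refine Prod.ext ?_ ?_
    · rw [chainCurve_fst, sineSeg_coe ha hb]; ring
    · rw [chainCurve_snd, sineSeg_coe ha hb, ← mul_assoc, ← mul_pow]
      simp
  simp_rw [h2]
  have h3 : Tendsto (fun i => chainScale (n + i)) atTop (𝓝 0) := by
    simpa only [add_comm] using (tendsto_add_atTop_iff_nat n).2 tendsto_chainScale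
  have h4 := (tendsto_const_nhds (x := (-2 : ℝ))).sub h3 |>.prodMk_nhds
    (tendsto_const_nhds (x := w.1.2))
  rwa [show ((-2 - 0 : ℝ), w.1.2) = w.1 from Prod.ext (by simp [hw]) rfl] at h4

instance : PreconnectedSpace sineCurvesToArc := by
  refine ⟨(isPreconnected_iUnion_chainCurve 0).subset_closure (subset_univ _) fun w _ => ?_⟩
  rcases sineCurvesToArc_cases w with h | ⟨i, p, rfl⟩
  · exact mem_closure_iUnion_chainCurve 0 h.1
  · exact subset_closure (mem_iUnion.2 ⟨i, p, by rw [zero_add]⟩)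

/-! ### The quotients: metrizability, sum decomposition, chain structure -/

/-- The plane map which collapses exactly the line `x = -2`. -/
def squash (p : ℝ × ℝ) : ℝ × ℝ := (p.1, (p.1 + 2) * p.2)

theorem continuous_squash : Continuous squash := by
  unfold squash; fun_prop

theorem squash_eq_iff {p q : ℝ × ℝ} : squash p = squash q ↔ p = q ∨ p.1 = -2 ∧ q.1 = -2 := by
  constructor
  · intro h
    obtain ⟨h1, h2⟩ : p.1 = q.1 ∧ (p.1 + 2) * p.2 = (q.1 + 2) * q.2 := Prod.mk.inj h
    by_cases hp : p.1 = -2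
    · exact Or.inr ⟨hp, h1 ▸ hp⟩
    · rw [← h1] at h2
      exact Or.inl (Prod.ext h1 (mul_left_cancel₀ (fun h => hp (by linarith)) h2))
  · rintro (rfl | ⟨h1, h2⟩)
    · rfl
    · simp [squash, h1, h2]

/-- The collapse of the limit arc, realized in the plane. -/
def collapseToPlane (T : Set (ℝ × ℝ)) :
    Quotient (collapseSetoid T limitArc) → ℝ × ℝ :=
  Quotient.lift (fun p : T => squash p) (by
    rintro p q (rfl | ⟨h1, h2⟩)
    · rfl
    · exact squash_eq_iff.2 (Or.inr ⟨h1.1, h2.1⟩))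

/-- A continuous injection of a compact space into the plane is an embedding; metrizability of both
quotients is read off from it. -/
theorem isEmbedding_collapseToPlane {T : Set (ℝ × ℝ)} [CompactSpace T]
    (hT : ∀ p ∈ T, p.1 = -2 → p ∈ limitArc) : IsEmbedding (collapseToPlane T) := by
  have hc : Continuous (collapseToPlane T) :=
    (continuous_squash.comp continuous_subtype_val).quotient_lift _
  refine (hc.isClosedEmbedding ?_).isEmbedding
  intro a b
  induction a using Quotient.inductionOn with | _ p => ?_
  induction b using Quotient.inductionOn with | _ q => ?_
  intro h
  refine Quotient.sound ?_
  rcases squash_eq_iff.1 h with h | ⟨h1, h2⟩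
  · exact Or.inl (Subtype.ext h)
  · exact Or.inr ⟨hT p p.2 h1, hT q q.2 h2⟩

theorem mem_limitArc_of_sineCurvesToArc {p : ℝ × ℝ} (hp : p ∈ sineCurvesToArc) (h : p.1 = -2) :
    p ∈ limitArc :=
  ⟨h, (sineCurvesToArc_bounds ⟨p, hp⟩).2.2⟩

theorem mem_limitArc_of_spaceZ {p : ℝ × ℝ} (hp : p ∈ spaceZ) (h : p.1 = -2) : p ∈ limitArc := by
  rcases hp with hp | hp
  · exact mem_limitArc_of_sineCurvesToArc hp h
  · linarith [(extendedSineCurve_bounds hp).1]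

instance : CompactSpace spaceZ :=
  isCompact_iff_compactSpace.1 ((isCompact_iff_compactSpace.2 inferInstance).union
    (isCompact_iff_compactSpace.2 inferInstance))

/-- The quotient of `sineCurvesToArc` by its limit arc. -/
abbrev SineChain : Type := Quotient (collapseSetoid sineCurvesToArc limitArc)

/-- The quotient of `spaceZ` by the limit arc. -/
abbrev CollapsedZ : Type := Quotient (collapseSetoid spaceZ limitArc)

instance : TopologicalSpace.MetrizableSpace SineChain :=
  (isEmbedding_collapseToPlane fun _ => mem_limitArc_of_sineCurvesToArc).metrizableSpace

instance : TopologicalSpace.MetrizableSpace CollapsedZ :=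
  (isEmbedding_collapseToPlane fun _ => mem_limitArc_of_spaceZ).metrizableSpace

/-- The space `spaceZ` is the topological sum of its two parts. -/
def sumHomeoSpaceZ : sineCurvesToArc ⊕ extendedSineCurve ≃ₜ spaceZ :=
  Continuous.homeoOfEquivCompactToT2 (f := Equiv.ofBijective
    (Sum.elim (fun w => (⟨w, Or.inl w.2⟩ : spaceZ)) (fun p => ⟨p, Or.inr p.2⟩)) (by
      have key : ∀ (w : sineCurvesToArc) (p : extendedSineCurve), w.1 ≠ p.1 := by
        intro w p h
        have h1 := (sineCurvesToArc_bounds w).2.1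
        have h2 := (extendedSineCurve_bounds p.2).1
        rw [h] at h1
        linarith
      constructor
      · rintro (a | a) (b | b) h <;>
          replace h := congrArg (Subtype.val : spaceZ → ℝ × ℝ) h
        · exact congrArg _ (Subtype.ext h)
        · exact absurd h (key _ _)
        · exact absurd h.symm (key _ _)
        · exact congrArg _ (Subtype.ext h)
      · rintro ⟨z, hz | hz⟩
        · exact ⟨Sum.inl ⟨z, hz⟩, rfl⟩
        · exact ⟨Sum.inr ⟨z, hz⟩, rfl⟩))
    (by
      refine Continuous.sumElim ?_ ?_ <;> fun_prop)

theorem sumHomeoSpaceZ_inl (w : sineCurvesToArc) : (sumHomeoSpaceZ (Sum.inl w) : ℝ × ℝ) = w := rfl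
theorem sumHomeoSpaceZ_inr (w : extendedSineCurve) : (sumHomeoSpaceZ (Sum.inr w) : ℝ × ℝ) = w := rfl

/-- The class of a point. -/
def SineChain.mk (w : sineCurvesToArc) : SineChain := Quotient.mk _ w

theorem SineChain.continuous_mk : Continuous SineChain.mk := continuous_quotient_mk'

theorem SineChain.mk_surjective : Function.Surjective SineChain.mk := Quotient.mk_surjective

theorem SineChain.mk_eq_mk {v w : sineCurvesToArc} :
    SineChain.mk v = SineChain.mk w ↔ v = w ∨ v.1.1 = -2 ∧ w.1.1 = -2 := by
  unfold SineChain.mk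
  rw [Quotient.eq]
  exact or_congr_right ⟨fun h => ⟨h.1.1, h.2.1⟩, fun h =>
    ⟨mem_limitArc_of_sineCurvesToArc v.2 h.1, mem_limitArc_of_sineCurvesToArc w.2 h.2⟩⟩

/-- The sum decomposition of the quotient, on points of the sum decomposition of `spaceZ`. -/
def toSumChain : sineCurvesToArc ⊕ extendedSineCurve → extendedSineCurve ⊕ SineChain :=
  Sum.elim (fun w => Sum.inr (SineChain.mk w)) Sum.inl

theorem continuous_toSumChain : Continuous toSumChain :=
  Continuous.sumElim (continuous_inr.comp SineChain.continuous_mk) continuous_inl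

theorem toSumChain_eq_iff {a b : sineCurvesToArc ⊕ extendedSineCurve} :
    toSumChain a = toSumChain b ↔
      a = b ∨ (sumHomeoSpaceZ a).1.1 = -2 ∧ (sumHomeoSpaceZ b).1.1 = -2 := by
  have h : ∀ p : extendedSineCurve, p.1.1 ≠ -2 := fun p h => by
    linarith [(extendedSineCurve_bounds p.2).1]
  rcases a with a | a <;> rcases b with b | b <;>
    simp [toSumChain, sumHomeoSpaceZ_inl, sumHomeoSpaceZ_inr, SineChain.mk_eq_mk, h]

/-- The quotient of `spaceZ` is the topological sum of the extended sine curve and the chain. -/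
def collapsedHomeoSum : CollapsedZ ≃ₜ extendedSineCurve ⊕ SineChain :=
  have hz : ∀ a b : spaceZ, toSumChain (sumHomeoSpaceZ.symm a) = toSumChain (sumHomeoSpaceZ.symm b)
      ↔ (collapseSetoid spaceZ limitArc).r a b := by
    intro a b
    rw [toSumChain_eq_iff, sumHomeoSpaceZ.apply_symm_apply, sumHomeoSpaceZ.apply_symm_apply,
      sumHomeoSpaceZ.symm.injective.eq_iff]
    exact or_congr_right ⟨fun h => ⟨mem_limitArc_of_spaceZ a.2 h.1,
      mem_limitArc_of_spaceZ b.2 h.2⟩, fun h => ⟨h.1.1, h.2.1⟩⟩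
  Continuous.homeoOfEquivCompactToT2 (f := Equiv.ofBijective
    (Quotient.lift (fun z => toSumChain (sumHomeoSpaceZ.symm z)) fun a b h => (hz a b).2 h) (by
      constructor
      · intro a b
        induction a using Quotient.inductionOn with | _ a => ?_
        induction b using Quotient.inductionOn with | _ b => ?_
        exact fun h => Quotient.sound ((hz a b).1 h)
      · rintro (p | c)
        · exact ⟨Quotient.mk _ (sumHomeoSpaceZ (Sum.inr p)), by simp [toSumChain]⟩
        · obtain ⟨w, rfl⟩ := SineChain.mk_surjective c
          exact ⟨Quotient.mk _ (sumHomeoSpaceZ (Sum.inl w)), by simp [toSumChain]⟩))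
    ((continuous_toSumChain.comp sumHomeoSpaceZ.symm.continuous).quotient_lift _)

/-- The limit point of the chain. -/
def SineChain.limit : SineChain := SineChain.mk ⟨(-2, 0), Or.inl (by norm_num [limitArc])⟩

theorem SineChain.mk_eq_limit {w : sineCurvesToArc} : SineChain.mk w = limit ↔ w.1.1 = -2 := by
  rw [SineChain.limit, SineChain.mk_eq_mk]
  constructor
  · rintro (rfl | h)
    · rfl
    · exact h.1
  · exact fun h => Or.inr ⟨h, rfl⟩

/-- The curves of the chain. -/
def SineChain.curve (i : ℕ) (p : closure sineCurve) : SineChain := SineChain.mk (chainCurve i p)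

theorem SineChain.continuous_curve (i : ℕ) : Continuous (SineChain.curve i) :=
  SineChain.continuous_mk.comp (continuous_chainCurve i)

theorem SineChain.curve_eq_iff {i j : ℕ} {p q : closure sineCurve} :
    SineChain.curve i p = SineChain.curve j q ↔ chainCurve i p = chainCurve j q := by
  unfold SineChain.curve
  rw [SineChain.mk_eq_mk, or_iff_left]
  exact fun h => (chainCurve_fst_lt i p).ne h.1

theorem SineChain.curve_ne_limit (i : ℕ) (p : closure sineCurve) :
    SineChain.curve i p ≠ SineChain.limit := fun h =>
  (chainCurve_fst_lt i p).ne (SineChain.mk_eq_limit.1 h)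

theorem SineChain.curve_low (i : ℕ) :
    SineChain.curve i sineLow = SineChain.curve (i + 1) sineEnd :=
  SineChain.curve_eq_iff.2 (chainCurve_low i)

theorem SineChain.cases (c : SineChain) : c = SineChain.limit ∨ ∃ i p, SineChain.curve i p = c := by
  obtain ⟨w, rfl⟩ := SineChain.mk_surjective c
  rcases sineCurvesToArc_cases w with ⟨h, -⟩ | ⟨i, p, rfl⟩
  · exact Or.inl (SineChain.mk_eq_limit.2 h)
  · exact Or.inr ⟨i, p, rfl⟩

/-- Outside the preimage of an open neighbourhood of the limit, W is compact and misses the arc, so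
the first coordinate, if there are such points, has a maximum below -2 there. Late curves lie beyond
it. -/
theorem SineChain.eventually_range_subset {U : Set SineChain} (hU : U ∈ 𝓝 SineChain.limit) :
    ∀ᶠ i in atTop, range (SineChain.curve i) ⊆ U := by
  obtain ⟨V, hVU, hV, hlV⟩ := mem_nhds_iff.1 hU
  set K : Set sineCurvesToArc := (SineChain.mk ⁻¹' V)ᶜ with hK
  have hKc : IsCompact K := (hV.preimage SineChain.continuous_mk).isClosed_compl.isCompact
  have hKlt : ∀ w ∈ K, w.1.1 < -2 := by
    intro w hw
    refine lt_of_le_of_ne (sineCurvesToArc_bounds w).2.1 fun h => hw ?_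
    rwa [mem_preimage, SineChain.mk_eq_limit.2 h]
  rcases K.eq_empty_or_nonempty with h0 | h0
  · refine Eventually.of_forall fun i => ?_
    rintro _ ⟨p, rfl⟩
    by_contra h
    have h1 : chainCurve i p ∈ K := fun h' => h (hVU h')
    rw [h0] at h1
    exact h1
  · obtain ⟨w, hw, hmax⟩ := hKc.exists_isMaxOn h0
      (f := fun v : sineCurvesToArc => v.1.1) (by fun_prop)
    obtain ⟨N, hN⟩ := exists_scale_lt (hKlt w hw)
    filter_upwards [eventually_ge_atTop N] with i hi
    rintro _ ⟨p, rfl⟩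
    by_contra h
    have h1 := hmax (a := chainCurve i p) fun h' => h (hVU h')
    have h2 := (chainCurve_fst_bounds i p).1
    have h3 := chainScale_antitone hi
    have h4 : (chainCurve i p).1.1 ≤ w.1.1 := h1
    linarith

theorem isChainOfSineCurves_sineChain : IsChainOfSineCurves SineChain := by
  refine ⟨inferInstance, SineChain.limit, SineChain.curve, fun i => SineChain.curve i sineLow,
    fun i => ?_, ?_, ?_, fun U => SineChain.eventually_range_subset, fun i => ?_, fun i j hij => ?_,
    fun i => ⟨sineLow, Or.inr rfl, rfl⟩, fun i => ⟨sineEnd, rfl, (SineChain.curve_low i).symm⟩⟩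
  · refine ((SineChain.continuous_curve i).isClosedEmbedding fun p q h => ?_).isEmbedding
    exact chainCurve_injective i (SineChain.curve_eq_iff.1 h)
  · refine eq_univ_of_forall fun c => ?_
    rcases SineChain.cases c with rfl | ⟨i, p, rfl⟩
    · exact Or.inr rfl
    · exact Or.inl (mem_iUnion.2 ⟨i, p, rfl⟩)
  · rintro i ⟨p, hp⟩
    exact SineChain.curve_ne_limit i p hp
  · refine Subset.antisymm ?_ ?_
    · rintro _ ⟨⟨p, rfl⟩, q, hq⟩
      obtain ⟨-, rfl, -⟩ := eq_of_chainCurve_eq (Nat.lt_succ_self i)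
        (SineChain.curve_eq_iff.1 hq).symm
      rfl
    · rintro _ rfl
      exact ⟨⟨_, rfl⟩, _, (SineChain.curve_low i).symm⟩
  · rw [Set.disjoint_left]
    rintro _ ⟨p, rfl⟩ ⟨q, hq⟩
    have := (eq_of_chainCurve_eq (by omega) (SineChain.curve_eq_iff.1 hq).symm).1
    omega

/-! ### Criteria for a closed set to be an α-limit set -/

section AlphaLimit

variable {X Y : Type*} [TopologicalSpace X] [TopologicalSpace Y]

theorem mem_alphaLimitSet {f : X → X} {x y : X} : y ∈ alphaLimitSet f x ↔
    ∀ U ∈ 𝓝 y, ∀ n, ∃ k, n ≤ k ∧ ∃ z ∈ U, f^[k] z = x := by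
  simp only [alphaLimitSet, mem_iInter, mem_closure_iff_nhds]
  constructor
  · intro h U hU n
    obtain ⟨z, hzU, hz⟩ := h n U hU
    obtain ⟨k, hk, hz⟩ := mem_iUnion₂.1 hz
    exact ⟨k, hk, z, hzU, hz⟩
  · intro h n U hU
    obtain ⟨k, hk, z, hzU, hz⟩ := h U hU n
    exact ⟨z, hzU, mem_iUnion₂.2 ⟨k, hk, hz⟩⟩

theorem isClosed_alphaLimitSet (f : X → X) (x : X) : IsClosed (alphaLimitSet f x) :=
  isClosed_iInter fun _ => isClosed_closure

theorem hasAFProperty_iff : HasAFProperty X ↔ ∀ A : Set X, IsClosed A → IsAlphaLimitSet A := by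
  constructor
  · intro h A hA
    exact h.ge hA
  · intro h
    refine Subset.antisymm ?_ fun A => h A
    rintro _ ⟨f, -, x, rfl⟩
    exact isClosed_alphaLimitSet f x

theorem IsAlphaLimitSet.image_homeomorph {A : Set X} (h : IsAlphaLimitSet A) (e : X ≃ₜ Y) :
    IsAlphaLimitSet (e '' A) := by
  obtain ⟨f, hf, x, rfl⟩ := h
  refine ⟨e ∘ f ∘ e.symm, by fun_prop, e x, ?_⟩
  have hsemi : Function.Semiconj e f (e ∘ f ∘ e.symm) := fun z => by simp
  ext y
  obtain ⟨y, rfl⟩ := e.surjective y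
  rw [e.injective.mem_set_image, mem_alphaLimitSet, mem_alphaLimitSet]
  constructor
  · intro h U hU n
    obtain ⟨k, hk, z, hz, hzx⟩ := h _ (e.continuous.continuousAt hU) n
    exact ⟨k, hk, e z, hz, by rw [← hsemi.iterate_right k z, hzx]⟩
  · intro h U hU n
    obtain ⟨k, hk, _, ⟨z, hz, rfl⟩, hzx⟩ := h _ (e.isOpenMap.image_mem_nhds hU) n
    rw [← hsemi.iterate_right k z] at hzx
    exact ⟨k, hk, z, hz, e.injective hzx⟩

theorem HasAFProperty.of_homeomorph (h : HasAFProperty X) (e : X ≃ₜ Y) : HasAFProperty Y := by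
  rw [hasAFProperty_iff] at h ⊢
  intro A hA
  have := (h _ (hA.preimage e.continuous)).image_homeomorph e
  rwa [image_preimage_eq _ e.surjective] at this

/-- A closed set which is a full fibre, over one of its points, of a map that otherwise avoids
it. -/
theorem isAlphaLimitSet_of_fiber {A : Set X} (hA : IsClosed A) {f : X → X} (hf : Continuous f)
    {a : X} (ha : a ∈ A) (h1 : ∀ y ∈ A, f y = a) (h2 : ∀ y ∉ A, f y ∉ A) : IsAlphaLimitSet A := by
  refine ⟨f, hf, a, ?_⟩
  -- At every positive time the fibre over `a` is A itself: A goes to `a`, which is again in A, and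
  -- the complement of A never enters A.
  have key : ∀ k y, f^[k + 1] y = a ↔ y ∈ A := by
    intro k
    induction k with
    | zero =>
      intro y
      exact ⟨fun h => by_contra fun hy => h2 y hy (by rwa [← h] at ha), h1 y⟩
    | succ k ih =>
      intro y
      rw [Function.iterate_succ_apply, ih]
      exact ⟨fun h => by_contra fun hy => h2 y hy h, fun h => (h1 y h).symm ▸ ha⟩
  ext y
  rw [mem_alphaLimitSet]
  constructor
  · intro hy U hU n
    exact ⟨n + 1, by omega, y, mem_of_mem_nhds hU, (key n y).2 hy⟩
  · intro h
    by_contra hy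
    obtain ⟨k, hk, z, hz, hzx⟩ := h _ (hA.isOpen_compl.mem_nhds hy) 1
    obtain ⟨k, rfl⟩ : ∃ j, k = j + 1 := ⟨k - 1, by omega⟩
    exact hz ((key k z).1 hzx)

theorem isAlphaLimitSet_empty_of_ne {a b : X} (hab : a ≠ b) :
    IsAlphaLimitSet (∅ : Set X) := by
  refine ⟨fun _ => a, continuous_const, b, ?_⟩
  refine (eq_empty_of_forall_notMem fun y hy => ?_).symm
  obtain ⟨k, hk, z, -, hz⟩ := mem_alphaLimitSet.1 hy _ univ_mem 1
  obtain ⟨k, rfl⟩ : ∃ j, k = j + 1 := ⟨k - 1, by omega⟩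
  rw [Function.iterate_succ_apply'] at hz
  exact hab hz

theorem IsClopen.isAlphaLimitSet {A : Set X} (hA : IsClopen A) (hne : A.Nonempty) :
    IsAlphaLimitSet A := by
  classical
  obtain ⟨a, ha⟩ := hne
  rcases eq_or_ne A univ with rfl | hu
  · exact isAlphaLimitSet_of_fiber isClosed_univ (f := fun _ => a) continuous_const ha
      (fun _ _ => rfl) fun y hy => absurd (mem_univ y) hy
  · obtain ⟨b, hb⟩ := (ne_univ_iff_exists_notMem A).1 hu
    refine isAlphaLimitSet_of_fiber hA.isClosed (f := A.piecewise (fun _ => a) fun _ => b) ?_ ha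
      (fun y hy => piecewise_eq_of_mem _ _ _ hy) fun y hy => ?_
    · refine Continuous.piecewise ?_ continuous_const continuous_const
      simp [hA.frontier_eq]
    · rwa [piecewise_eq_of_notMem _ _ _ hy]

end AlphaLimit

/-- A closed set which meets a path component without containing it is an `α`-limit set. -/
theorem isAlphaLimitSet_of_joined {X : Type*} [TopologicalSpace X]
    [TopologicalSpace.MetrizableSpace X] {A : Set X} (hA : IsClosed A)
    {p q : X} (hpq : Joined p q) (hp : p ∈ A) (hq : q ∉ A) : IsAlphaLimitSet A := by
  let _ := TopologicalSpace.metrizableSpaceMetric X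
  obtain ⟨γ⟩ := hpq
  set B : Set ℝ := {t | t ∈ Icc (0 : ℝ) 1 ∧ γ.extend t ∈ A}
  have hBc : IsCompact B := isCompact_Icc.inter_right (hA.preimage γ.continuous_extend)
  -- The last time at which the path is in A. The map below sends points of A to the path at time
  -- `a`, and all other points to strictly later times, hence outside A.
  obtain ⟨a, haB, ha⟩ := hBc.exists_isGreatest ⟨0, by simp, by simpa using hp⟩
  have ha1 : a < 1 := by
    refine lt_of_le_of_ne haB.1.2 ?_
    rintro rfl
    exact hq (by simpa using haB.2)
  refine isAlphaLimitSet_of_fiber hA (a := γ.extend a)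
    (f := fun y => γ.extend (a + (1 - a) * min 1 (Metric.infDist y A))) ?_ haB.2 ?_ ?_
  · exact γ.continuous_extend.comp (continuous_const.add (continuous_const.mul
      (continuous_const.min (Metric.continuous_infDist_pt A))))
  · intro y hy
    simp [Metric.infDist_zero_of_mem hy]
  · intro y hy hfy
    have hd : 0 < min 1 (Metric.infDist y A) :=
      lt_min one_pos ((hA.notMem_iff_infDist_pos ⟨p, hp⟩).1 hy)
    have hd1 : min 1 (Metric.infDist y A) ≤ 1 := min_le_left _ _
    have h1 : 0 < (1 - a) * min 1 (Metric.infDist y A) := mul_pos (by linarith) hd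
    have := ha (show a + (1 - a) * min 1 (Metric.infDist y A) ∈ B from
      ⟨⟨by linarith [haB.1.1], by nlinarith⟩, hfy⟩)
    linarith

/-- The preimage of the `α`-limit set of a fixed point under a retraction is an `α`-limit set if it
is the union of a fibre and of sections. -/
theorem isAlphaLimitSet_preimage_of_sections {K Y : Type*} [TopologicalSpace K]
    [TopologicalSpace Y] {F : K → K} (hF : Continuous F) {x₀ : K} (hx₀ : F x₀ = x₀) {B : Set K}
    (hB : IsClosed B) (hFB : ∀ p, F p ∈ B → p ∈ B) (hxB : x₀ ∈ B)
    (hdense : ∀ n, B ⊆ closure {p | ∃ k, n ≤ k ∧ F^[k] p = x₀})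
    {φ : K → Y} (hφ : Continuous φ) {π : Y → K} (hπ : Continuous π) (hπφ : ∀ p, π (φ p) = p)
    (hsec : ∀ y, π y ∈ B → π y = x₀ ∨
      ∃ σ : K → Y, ContinuousOn σ B ∧ (∀ p ∈ B, π (σ p) = p) ∧ σ (π y) = y) :
    IsAlphaLimitSet (π ⁻¹' B) := by
  -- As π ∘ φ is the identity, the preimages of φ x₀ at positive times are the π-preimages of those
  -- of x₀ under F. Their density over B has to be lifted: a point over x₀ is itself such a
  -- preimage, and any other point lies on a section along which nearby preimages lift.
  refine ⟨φ ∘ F ∘ π, hφ.comp (hF.comp hπ), φ x₀, ?_⟩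
  have hiter : ∀ k y, (φ ∘ F ∘ π)^[k + 1] y = φ (F^[k + 1] (π y)) := by
    intro k
    induction k with
    | zero => intro y; rfl
    | succ k ih =>
      intro y
      rw [Function.iterate_succ_apply', ih, Function.iterate_succ_apply' F (k + 1)]
      simp only [Function.comp_apply, hπφ]
  have hiter' : ∀ k y, (φ ∘ F ∘ π)^[k + 1] y = φ x₀ ↔ F^[k + 1] (π y) = x₀ := by
    intro k y
    rw [hiter]
    exact (Function.LeftInverse.injective hπφ).eq_iff
  have hback : ∀ k p, F^[k] p = x₀ → p ∈ B := by
    intro k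
    induction k with
    | zero => rintro p rfl; exact hxB
    | succ k ih =>
      intro p hp
      exact hFB p (ih _ hp)
  ext y
  rw [mem_alphaLimitSet]
  constructor
  · intro hy U hU n
    rcases hsec y hy with h | ⟨σ, hσ, hπσ, hσy⟩
    · exact ⟨n + 1, by omega, y, mem_of_mem_nhds hU,
        (hiter' n y).2 (by rw [h, Function.iterate_fixed hx₀])⟩
    · have h1 : ContinuousWithinAt σ B (π y) := hσ _ hy
      have hU' : σ ⁻¹' U ∈ 𝓝[B] (π y) := h1 (by rwa [hσy])
      obtain ⟨V, hV, hVU⟩ := mem_nhdsWithin_iff_exists_mem_nhds_inter.1 hU'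
      obtain ⟨p, hpV, k, hk, hp⟩ := mem_closure_iff_nhds.1 (hdense (n + 1) hy) V hV
      have hpB := hback k p hp
      obtain ⟨k, rfl⟩ : ∃ j, k = j + 1 := ⟨k - 1, by omega⟩
      exact ⟨k + 1, by omega, σ p, hVU ⟨hpV, hpB⟩, (hiter' k _).2 (by rwa [hπσ p hpB])⟩
  · intro h
    by_contra hy
    obtain ⟨k, hk, z, hz, hzx⟩ := h _ ((hB.preimage hπ).isOpen_compl.mem_nhds hy) 1
    obtain ⟨k, rfl⟩ : ∃ j, k = j + 1 := ⟨k - 1, by omega⟩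
    exact hz (hback _ _ ((hiter' k z).1 hzx))

/-- The preimages of the lower end of a vertical segment are dense in the segment, for a map that
folds the segment. -/
theorem segment_subset_closure_preimages {K : Set (ℝ × ℝ)} {F : K → K} {c : ℝ}
    (hF1 : ∀ p : K, p.1.1 = c → (F p).1.1 = c) (hF2 : ∀ p : K, (F p).1.2 = foldMap p.1.2)
    (hK : ∀ y, -1 ≤ y → y ≤ 1 → (c, y) ∈ K) (hK' : ∀ p ∈ K, -1 ≤ p.2 ∧ p.2 ≤ 1)
    {x₀ : K} (hx₀ : x₀.1 = (c, -1)) (n : ℕ) :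
    {p : K | p.1.1 = c} ⊆ closure {p | ∃ k, n ≤ k ∧ F^[k] p = x₀} := by
  intro p hp
  rw [Metric.mem_closure_iff]
  intro ε hε
  have hlim : Tendsto (fun k : ℕ => Real.pi / 3 ^ k) atTop (𝓝 0) :=
    tendsto_const_nhds.div_atTop (tendsto_pow_atTop_atTop_of_one_lt (by norm_num))
  obtain ⟨k, hkε, hk⟩ := ((hlim.eventually_lt_const hε).and (eventually_ge_atTop n)).exists
  obtain ⟨z, hz1, hz2, hz, hzy⟩ := exists_iterate_foldMap_eq_neg_one (hK' p p.2).1 (hK' p p.2).2 k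
  refine ⟨⟨(c, z), hK z hz1 hz2⟩, ⟨k, hk, ?_⟩, ?_⟩
  · have key : ∀ j, (F^[j] ⟨(c, z), hK z hz1 hz2⟩).1 = (c, foldMap^[j] z) := by
      intro j
      induction j with
      | zero => rfl
      | succ j ih =>
        rw [Function.iterate_succ_apply', Function.iterate_succ_apply']
        exact Prod.ext (hF1 _ (by rw [ih])) (by rw [hF2, ih])
    exact Subtype.ext (by rw [key, hz, hx₀])
  · rw [Subtype.dist_eq, Prod.dist_eq]
    refine max_lt ?_ ?_
    · rw [show p.1.1 = c from hp, dist_self]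
      exact hε
    · rw [dist_comm, Real.dist_eq]
      exact hzy.trans_lt hkε

/-! ### Closed unions of path components -/

theorem eq_univ_of_joined_closed {B : Set (closure sineCurve)} (hB : IsClosed B)
    (hsat : ∀ p q, Joined p q → p ∈ B → q ∈ B) {p : closure sineCurve} (hp : p ∈ B)
    (hp0 : 0 < p.1.1) : B = univ := by
  refine eq_univ_of_forall fun q => closure_minimal (s := {q : closure sineCurve | 0 < q.1.1})
    (fun q hq => hsat p q (joined_of_fst_pos hp0 hq) hp) hB ?_
  rw [closure_subtype]
  refine closure_mono (fun v hv => ?_) q.2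
  exact ⟨⟨v, subset_closure hv⟩, hv.1, rfl⟩

theorem extendedSineCurve_eq_sineIncl {p : extendedSineCurve} (hp : 0 < p.1.1) :
    ∃ q, 0 < q.1.1 ∧ sineIncl q = p :=
  ⟨⟨p, subset_closure (mem_sineCurve_of_extended p.2 hp)⟩, hp, rfl⟩

/-- The point of the horizontal segment with first coordinate `-t`. -/
def tailPoint (t : unitInterval) : extendedSineCurve :=
  ⟨(-t, -1), Or.inr ⟨neg_le_neg t.2.2, neg_nonpos.2 t.2.1, rfl⟩⟩

theorem continuous_tailPoint : Continuous tailPoint := by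
  unfold tailPoint; fun_prop

theorem extended_cases {p : extendedSineCurve} (hp : p.1.1 ≤ 0) :
    (∃ q, q.1.1 = 0 ∧ sineIncl q = p) ∨ ∃ t, tailPoint t = p := by
  obtain ⟨p, h | h⟩ := p
  · exact Or.inl ⟨⟨p, h⟩, le_antisymm hp (closure_sineCurve_bounds h).1, rfl⟩
  · refine Or.inr ⟨⟨-p.1, neg_nonneg.2 h.2.1, by linarith [h.1]⟩, Subtype.ext (Prod.ext ?_ ?_)⟩
    · simp [tailPoint]
    · simp [tailPoint, h.2.2]

theorem joined_sineIncl_sineLow {p : extendedSineCurve} (hp : p.1.1 ≤ 0) :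
    Joined (sineIncl sineLow) p := by
  rcases extended_cases hp with ⟨q, hq, rfl⟩ | ⟨t, rfl⟩
  · exact (joined_of_fst_eq_zero rfl hq).map continuous_sineIncl
  · have : PathConnectedSpace unitInterval := isPathConnected_iff_pathConnectedSpace.1
      ((convex_Icc _ _).isPathConnected ⟨0, unitInterval.zero_mem⟩)
    have h := (PathConnectedSpace.joined (0 : unitInterval) t).map continuous_tailPoint
    rwa [show tailPoint 0 = sineIncl sineLow from
      Subtype.ext (Prod.ext (by simp [tailPoint, sineIncl, sineLow_coe]) rfl)] at h

/-- There are two path components, the sine curve and its complement. The closure of the first meets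
the second, so only the second is closed by itself. -/
theorem closed_saturated_extended {B : Set extendedSineCurve} (hB : IsClosed B)
    (hsat : ∀ p q, Joined p q → p ∈ B → q ∈ B) : B = ∅ ∨ B = univ ∨ B = {p | p.1.1 ≤ 0} := by
  have h1 : ∀ p ∈ B, 0 < p.1.1 → ∀ q, sineIncl q ∈ B := by
    intro p hp hp0
    obtain ⟨q, hq, rfl⟩ := extendedSineCurve_eq_sineIncl hp0
    exact fun q => (eq_univ_of_joined_closed (hB.preimage continuous_sineIncl)
      (fun p q h => hsat _ _ (h.map continuous_sineIncl)) hp hq).ge (mem_univ q)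
  by_cases hlow : sineIncl sineLow ∈ B
  · have h2 : ∀ p : extendedSineCurve, p.1.1 ≤ 0 → p ∈ B := fun p hp =>
      hsat _ _ (joined_sineIncl_sineLow hp) hlow
    by_cases h3 : ∃ p ∈ B, 0 < p.1.1
    · obtain ⟨p, hp, hp0⟩ := h3
      refine Or.inr (Or.inl (eq_univ_of_forall fun q => ?_))
      rcases le_or_gt q.1.1 0 with hq | hq
      · exact h2 q hq
      · obtain ⟨q, -, rfl⟩ := extendedSineCurve_eq_sineIncl hq
        exact h1 p hp hp0 q
    · push Not at h3
      exact Or.inr (Or.inr (Subset.antisymm (fun p hp => h3 p hp) h2))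
  · refine Or.inl (eq_empty_of_forall_notMem fun p hp => hlow ?_)
    rcases le_or_gt p.1.1 0 with hq | hq
    · exact hsat _ _ (joined_sineIncl_sineLow hq).symm hp
    · exact h1 p hp hq _

/-- The retraction of the extended sine curve to the closed sine curve. -/
def extendedRetract (p : extendedSineCurve) : closure sineCurve :=
  ⟨(max p.1.1 0, p.1.2), by
    obtain ⟨p, h | h⟩ := p
    · rwa [max_eq_left (closure_sineCurve_bounds h).1]
    · rw [max_eq_right h.2.1, h.2.2]
      exact sineLow.2⟩

theorem continuous_extendedRetract : Continuous extendedRetract := by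
  unfold extendedRetract; fun_prop

theorem extendedRetract_sineIncl (p : closure sineCurve) : extendedRetract (sineIncl p) = p :=
  Subtype.ext (Prod.ext (max_eq_left (closure_sineCurve_bounds p.2).1) rfl)

theorem extendedRetract_fst {p : extendedSineCurve} : (extendedRetract p).1.1 = 0 ↔ p.1.1 ≤ 0 :=
  max_eq_right_iff

theorem extendedRetract_tailPoint (t : unitInterval) : extendedRetract (tailPoint t) = sineLow :=
  Subtype.ext (Prod.ext (max_eq_right (neg_nonpos.2 t.2.1)) rfl)

/-- The projection of the closed sine curve to the limit arc. -/
def arcPoint (p : closure sineCurve) : sineCurvesToArc :=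
  ⟨(-2, p.1.2), Or.inl ⟨rfl, (closure_sineCurve_bounds p.2).2.2⟩⟩

theorem continuous_arcPoint : Continuous arcPoint := by
  unfold arcPoint; fun_prop

theorem exists_arcPoint {w : sineCurvesToArc} (hw : w.1.1 = -2) :
    ∃ p, p.1.1 = 0 ∧ arcPoint p = w := by
  obtain ⟨-, -, h1, h2⟩ := sineCurvesToArc_bounds w
  refine ⟨sineSeg w.1.2, rfl, Subtype.ext (Prod.ext hw.symm ?_)⟩
  simp [arcPoint, sineSeg_coe h1 h2]

/-- Membership spreads forward: a point of the i-th curve brings in its lower end, which is the end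
of the next curve, and with it by closedness that whole curve. Later curves accumulate on the arc.
So, apart from the empty set and the arc, the set is determined by the first curve it contains
entirely; if that curve has a predecessor, exactly the convergence segment of the predecessor
belongs to the set as well. -/
theorem closed_saturated_sineCurvesToArc {B : Set sineCurvesToArc} (hB : IsClosed B)
    (hsat : ∀ p q, Joined p q → p ∈ B → q ∈ B) : B = ∅ ∨ B = univ ∨ B = {w | w.1.1 = -2} ∨
      ∃ n, B = {w | (chainRetract n w).1.1 = 0} := by
  have h1 : ∀ i p, chainCurve i p ∈ B → 0 < p.1.1 → ∀ q, chainCurve i q ∈ B := by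
    intro i p hp hp0 q
    exact (eq_univ_of_joined_closed (hB.preimage (continuous_chainCurve i))
      (fun p q h => hsat _ _ (h.map (continuous_chainCurve i))) hp hp0).ge (mem_univ q)
  have h2 : ∀ i p, chainCurve i p ∈ B → ∀ q, chainCurve (i + 1) q ∈ B := by
    intro i p hp
    refine h1 (i + 1) sineEnd ?_ sineEnd_fst_pos
    rw [← chainCurve_low]
    rcases (closure_sineCurve_bounds p.2).1.eq_or_lt with h | h
    · exact hsat _ _ ((joined_of_fst_eq_zero h.symm rfl).map (continuous_chainCurve i)) hp
    · exact h1 i p hp h _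
  by_cases hex : ∃ i, ∀ p, chainCurve i p ∈ B
  · classical
    set n := Nat.find hex with hn
    have hn1 : ∀ p, chainCurve n p ∈ B := Nat.find_spec hex
    have hn2 : ∀ i < n, ¬ ∀ p, chainCurve i p ∈ B := fun i hi => Nat.find_min hex hi
    clear_value n
    have hge : ∀ i, ∀ p, chainCurve (n + i) p ∈ B := by
      intro i
      induction i with
      | zero => exact hn1
      | succ i ih => exact h2 _ sineLow (ih _)
    have harc : ∀ w : sineCurvesToArc, w.1.1 = -2 → w ∈ B := by
      intro w hw
      refine closure_minimal ?_ hB (mem_closure_iUnion_chainCurve n hw)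
      exact iUnion_subset fun i => range_subset_iff.2 (hge i)
    rcases n with _ | m
    · refine Or.inr (Or.inl (eq_univ_of_forall fun w => ?_))
      rcases sineCurvesToArc_cases w with h | ⟨i, p, rfl⟩
      · exact harc w h.1
      · simpa using hge i p
    · refine Or.inr (Or.inr (Or.inr ⟨m, ?_⟩))
      ext w
      rcases sineCurvesToArc_cases w with ⟨h, -⟩ | ⟨i, p, rfl⟩
      · exact iff_of_true (harc w h) (by rw [mem_ofPred_eq, chainRetract_arc m h]; rfl)
      · change _ ↔ (chainRetract m (chainCurve i p)).1.1 = 0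
        rcases lt_trichotomy i m with hi | rfl | hi
        · rw [chainRetract_of_lt hi]
          exact iff_of_false (fun h => hn2 (i + 1) (by omega) (h2 i p h)) sineEnd_fst_pos.ne'
        · rw [chainRetract_self]
          constructor
          · intro h
            by_contra hne
            exact hn2 i (by omega) (h1 i p h
              (lt_of_le_of_ne (closure_sineCurve_bounds p.2).1 (Ne.symm hne)))
          · intro h
            refine hsat (chainCurve i sineLow) _
              ((joined_of_fst_eq_zero rfl h).map (continuous_chainCurve i)) ?_
            rw [chainCurve_low]
            exact hn1 _
        · rw [chainRetract_of_gt hi]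
          obtain ⟨j, rfl⟩ := Nat.exists_eq_add_of_le (show m + 1 ≤ i from hi)
          exact iff_of_true (hge j p) rfl
  · have hsub : ∀ w ∈ B, w.1.1 = -2 := by
      intro w hw
      rcases sineCurvesToArc_cases w with h | ⟨i, p, rfl⟩
      · exact h.1
      · exact absurd ⟨i + 1, h2 i p hw⟩ hex
    rcases B.eq_empty_or_nonempty with h0 | ⟨v, hv⟩
    · exact Or.inl h0
    · refine Or.inr (Or.inr (Or.inl (Subset.antisymm hsub fun w hw => ?_)))
      obtain ⟨p, hp, rfl⟩ := exists_arcPoint hw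
      obtain ⟨q, hq, rfl⟩ := exists_arcPoint (hsub v hv)
      exact hsat _ _ ((joined_of_fst_eq_zero hq hp).map continuous_arcPoint) hv

/-! ### The `𝒜ℱ`-property of the sum of W and X -/

theorem isAlphaLimitSet_preimage_segment {Y : Type*} [TopologicalSpace Y]
    {φ : closure sineCurve → Y} (hφ : Continuous φ) {π : Y → closure sineCurve} (hπ : Continuous π)
    (hπφ : ∀ p, π (φ p) = p)
    (hsec : ∀ y, (π y).1.1 = 0 → π y = sineLow ∨
      ∃ σ : closure sineCurve → Y, Continuous σ ∧ (∀ p, p.1.1 = 0 → π (σ p) = p) ∧ σ (π y) = y) :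
    IsAlphaLimitSet {y | (π y).1.1 = 0} := by
  refine isAlphaLimitSet_preimage_of_sections (B := {p | p.1.1 = 0}) continuous_sineFold
    sineFold_sineLow (isClosed_eq (by fun_prop) continuous_const)
    (fun p hp => sineFold_fst_eq_zero.1 hp) rfl (fun n => ?_) hφ hπ hπφ fun y hy => ?_
  · exact segment_subset_closure_preimages (fun p => sineFold_fst_eq_zero.2) (fun _ => rfl)
      (fun y h1 h2 => mem_closure_sineCurve.2 (Or.inl ⟨rfl, h1, h2⟩))
      (fun p hp => (closure_sineCurve_bounds hp).2.2) rfl n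
  · exact (hsec y hy).imp_right fun ⟨σ, h1, h2⟩ => ⟨σ, h1.continuousOn, h2⟩

theorem isAlphaLimitSet_preimage_arc {Y : Type*} [TopologicalSpace Y]
    {φ : sineCurvesToArc → Y} (hφ : Continuous φ) {π : Y → sineCurvesToArc} (hπ : Continuous π)
    (hπφ : ∀ p, π (φ p) = p)
    (hsec : ∀ y, (π y).1.1 = -2 → π y = arcPoint sineLow ∨ φ (π y) = y) :
    IsAlphaLimitSet {y | (π y).1.1 = -2} := by
  refine isAlphaLimitSet_preimage_of_sections (B := {p | p.1.1 = -2}) (x₀ := arcPoint sineLow)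
    continuous_chainFold ?_ (isClosed_eq (by fun_prop) continuous_const)
    (fun p hp => chainFold_fst.1 hp) rfl (fun n => ?_) hφ hπ hπφ fun y hy => ?_
  · refine Subtype.ext (Prod.ext (chainFold_fst.2 rfl) ?_)
    simp [chainFold, arcPoint, sineLow_coe, foldMap]
    norm_num
  · exact segment_subset_closure_preimages (fun p => chainFold_fst.2) (fun _ => rfl)
      (fun y h1 h2 => Or.inl ⟨rfl, h1, h2⟩)
      (fun p hp => (sineCurvesToArc_bounds ⟨p, hp⟩).2.2) rfl n
  · exact (hsec y hy).imp_right fun h => ⟨φ, hφ.continuousOn, fun p _ => hπφ p, h⟩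

/-- Closed saturated subsets of `sineCurvesToArc` are preimages of the convergence segment under
maps with sections. -/
theorem exists_map_of_closed_saturated {B : Set sineCurvesToArc} (hB : IsClosed B)
    (hsat : ∀ p q, Joined p q → p ∈ B → q ∈ B) :
    ∃ ρ : sineCurvesToArc → closure sineCurve, Continuous ρ ∧ B = {w | (ρ w).1.1 = 0} ∧
      ∀ w, (ρ w).1.1 = 0 → ρ w = sineLow ∨ ∃ σ : closure sineCurve → sineCurvesToArc,
        Continuous σ ∧ (∀ p, p.1.1 = 0 → ρ (σ p) = p) ∧ σ (ρ w) = w := by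
  rcases closed_saturated_sineCurvesToArc hB hsat with rfl | rfl | rfl | ⟨n, rfl⟩
  · refine ⟨fun _ => sineEnd, continuous_const, ?_, fun w hw => absurd hw sineEnd_fst_pos.ne'⟩
    exact (eq_empty_of_forall_notMem fun w hw => sineEnd_fst_pos.ne' hw).symm
  · refine ⟨fun _ => sineLow, continuous_const, ?_, fun w _ => Or.inl rfl⟩
    exact (eq_univ_of_forall fun w => rfl).symm
  -- Here the arc must not be collapsed: `chainLap` carries it bijectively onto the convergence
  -- segment, with inverse `arcPoint`, and everything else into the sine curve.
  · refine ⟨chainLap, continuous_chainLap, by simp [chainLap_fst_eq_zero], fun w hw => Or.inr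
      ⟨arcPoint, continuous_arcPoint, fun p hp => ?_, ?_⟩⟩
    · exact Subtype.ext (Prod.ext ((lapCoord_arc rfl).trans hp.symm) rfl)
    · exact Subtype.ext (Prod.ext (chainLap_fst_eq_zero.1 hw).symm rfl)
  · refine ⟨chainRetract n, continuous_chainRetract n, rfl, fun w hw => ?_⟩
    rcases sineCurvesToArc_cases w with ⟨h, -⟩ | ⟨i, p, rfl⟩
    · exact Or.inl (chainRetract_arc n h)
    · rcases lt_trichotomy i n with hi | rfl | hi
      · rw [chainRetract_of_lt hi] at hw
        exact absurd hw sineEnd_fst_pos.ne'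
      · exact Or.inr ⟨chainCurve i, continuous_chainCurve i, fun p _ => chainRetract_self i p,
          by rw [chainRetract_self]⟩
      · exact Or.inl (chainRetract_of_gt hi p)

/-- With all or nothing of X in the set, X can be collapsed to one point `c`, placed over the folded
segment or arc when `s` holds and off it otherwise. The folding then takes place in W alone. -/
theorem isAlphaLimitSet_of_trivial_right {A : Set (sineCurvesToArc ⊕ extendedSineCurve)}
    (hA : IsClosed A) (hne : A.Nonempty) (hsat : ∀ p q, Joined p q → p ∈ A → q ∈ A) {s : Prop}
    (hs : ∀ p, Sum.inr p ∈ A ↔ s) : IsAlphaLimitSet A := by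
  classical
  have hAl : IsClosed (Sum.inl ⁻¹' A) := hA.preimage continuous_inl
  have hcl : IsOpen (Sum.inl ⁻¹' A) → IsAlphaLimitSet A := by
    refine fun ho => IsClopen.isAlphaLimitSet ⟨hA, isOpen_sum_iff.2 ⟨ho, ?_⟩⟩ hne
    by_cases h : s
    · convert isOpen_univ
      exact eq_univ_of_forall fun p => (hs p).2 h
    · convert isOpen_empty
      exact eq_empty_of_forall_notMem fun p hp => h ((hs p).1 hp)
  rcases closed_saturated_sineCurvesToArc hAl
    (fun p q h => hsat _ _ (h.map continuous_inl)) with h | h | h | ⟨n, h⟩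
  · exact hcl (h ▸ isOpen_empty)
  · exact hcl (h ▸ isOpen_univ)
  · set c : sineCurvesToArc := if s then arcPoint sineLow else chainCurve 0 sineEnd
    have hc : c.1.1 = -2 ↔ s := by
      by_cases hs : s
      · simp [c, hs, arcPoint]
      · simp [c, hs, (chainCurve_fst_lt 0 sineEnd).ne]
    convert isAlphaLimitSet_preimage_arc (Y := sineCurvesToArc ⊕ extendedSineCurve)
      (π := Sum.elim id fun _ => c) continuous_inl
      (continuous_id.sumElim continuous_const) (fun _ => rfl) ?_ using 1
    · ext (w | p)
      · exact Set.ext_iff.1 h w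
      · exact (hs p).trans hc.symm
    · rintro (w | p) hp
      · exact Or.inr rfl
      · exact Or.inl (if_pos (hc.1 hp))
  · set c : closure sineCurve := if s then sineLow else sineEnd
    have hc : c.1.1 = 0 ↔ s := by
      by_cases hs : s
      · simp [c, hs, sineLow_coe]
      · simp [c, hs, sineEnd_fst_pos.ne']
    convert isAlphaLimitSet_preimage_segment (Y := sineCurvesToArc ⊕ extendedSineCurve)
      (π := Sum.elim (chainRetract n) fun _ => c)
      (continuous_inl.comp (continuous_chainCurve n))
      ((continuous_chainRetract n).sumElim continuous_const)
      (fun p => chainRetract_self n p) ?_ using 1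
    · ext (w | p)
      · exact Set.ext_iff.1 h w
      · exact (hs p).trans hc.symm
    · rintro (w | p) hp
      · rcases sineCurvesToArc_cases w with ⟨h, -⟩ | ⟨i, p, rfl⟩
        · exact Or.inl (chainRetract_arc n h)
        · rcases lt_trichotomy i n with hi | rfl | hi
          · rw [Sum.elim_inl, chainRetract_of_lt hi] at hp
            exact absurd hp sineEnd_fst_pos.ne'
          · exact Or.inr ⟨_, continuous_inl.comp (continuous_chainCurve i),
              fun p _ => chainRetract_self i p, by simp [chainRetract_self]⟩
          · exact Or.inl (chainRetract_of_gt hi p)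
      · exact Or.inl (if_pos (hc.1 hp))

/-- In the remaining case, where the part in X is the complement of the sine curve, the folding
takes place in X, and W is mapped to the closed sine curve so that its part of the set lies exactly
over the segment. -/
theorem hasAFProperty_sum : HasAFProperty (sineCurvesToArc ⊕ extendedSineCurve) := by
  rw [hasAFProperty_iff]
  intro A hA
  have : TopologicalSpace.MetrizableSpace (sineCurvesToArc ⊕ extendedSineCurve) :=
    sumHomeoSpaceZ.isEmbedding.metrizableSpace
  rcases A.eq_empty_or_nonempty with rfl | hne
  · exact isAlphaLimitSet_empty_of_ne (a := Sum.inl (arcPoint sineLow))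
      (b := Sum.inr (sineIncl sineLow)) Sum.inl_ne_inr
  by_cases hsat : ∃ p q, Joined p q ∧ p ∈ A ∧ q ∉ A
  · obtain ⟨p, q, h, hp, hq⟩ := hsat
    exact isAlphaLimitSet_of_joined hA h hp hq
  push Not at hsat
  rcases closed_saturated_extended (hA.preimage continuous_inr)
    (fun p q h => hsat _ _ (h.map continuous_inr)) with h | h | h
  · exact isAlphaLimitSet_of_trivial_right hA hne hsat (s := False) fun p => Set.ext_iff.1 h p
  · exact isAlphaLimitSet_of_trivial_right hA hne hsat (s := True) fun p => Set.ext_iff.1 h p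
  · obtain ⟨ρ, hρ, hAρ, hsec⟩ := exists_map_of_closed_saturated (hA.preimage continuous_inl)
      (fun p q h => hsat _ _ (h.map continuous_inl))
    convert isAlphaLimitSet_preimage_segment (Y := sineCurvesToArc ⊕ extendedSineCurve)
      (π := Sum.elim ρ extendedRetract) (continuous_inr.comp continuous_sineIncl)
      (hρ.sumElim continuous_extendedRetract) (fun p => extendedRetract_sineIncl p) ?_ using 1
    · ext (w | p)
      · exact Set.ext_iff.1 hAρ w
      · exact (Set.ext_iff.1 h p).trans extendedRetract_fst.symm
    · rintro (w | p) hp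
      · exact (hsec w hp).imp_right fun ⟨σ, h1, h2, h3⟩ =>
          ⟨fun p => Sum.inl (σ p), continuous_inl.comp h1, h2, congrArg Sum.inl h3⟩
      · rcases extended_cases (extendedRetract_fst.1 hp) with ⟨q, hq, rfl⟩ | ⟨t, rfl⟩
        · exact Or.inr ⟨_, continuous_inr.comp continuous_sineIncl,
            fun p _ => extendedRetract_sineIncl p, by simp [extendedRetract_sineIncl]⟩
        · exact Or.inl (extendedRetract_tailPoint t)

theorem hasAFProperty_spaceZ : HasAFProperty spaceZ :=
  hasAFProperty_sum.of_homeomorph sumHomeoSpaceZ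

/-! ### Constraints on the dynamics around an α-limit set -/

section AlphaLimit

variable {Y : Type*} [TopologicalSpace Y] {f : Y → Y} {x : Y}

theorem map_mem_alphaLimitSet (hf : Continuous f) {y : Y} (hy : y ∈ alphaLimitSet f x) :
    f y ∈ alphaLimitSet f x := by
  rw [mem_alphaLimitSet] at hy ⊢
  intro U hU n
  obtain ⟨k, hk, z, hz, hzx⟩ := hy _ (hf.continuousAt hU) (n + 1)
  obtain ⟨k, rfl⟩ : ∃ j, k = j + 1 := ⟨k - 1, by omega⟩
  exact ⟨k, by omega, f z, hz, hzx⟩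

/-- Each point off the α-limit set has a neighbourhood free of late preimages of `x`; finitely many
of these cover K. -/
theorem IsCompact.eventually_iterate_ne {K : Set Y} (hK : IsCompact K)
    (hKα : Disjoint K (alphaLimitSet f x)) : ∃ N, ∀ k, N ≤ k → ∀ z ∈ K, f^[k] z ≠ x := by
  refine hK.induction_on (p := fun K => ∃ N, ∀ k, N ≤ k → ∀ z ∈ K, f^[k] z ≠ x) ⟨0, by simp⟩ ?_ ?_
    fun y hy => ?_
  · rintro s t hst ⟨N, hN⟩
    exact ⟨N, fun k hk z hz => hN k hk z (hst hz)⟩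
  · rintro s t ⟨N, hN⟩ ⟨M, hM⟩
    refine ⟨max N M, fun k hk z hz => ?_⟩
    rcases hz with hz | hz
    · exact hN k (le_of_max_le_left hk) z hz
    · exact hM k (le_of_max_le_right hk) z hz
  · have := Set.disjoint_left.1 hKα hy
    rw [mem_alphaLimitSet] at this
    push Not at this
    obtain ⟨U, hU, n, h⟩ := this
    exact ⟨U, mem_nhdsWithin_of_mem_nhds hU, n, h⟩

/-- A late preimage of `x` exists in D, and all points of D agree after m steps, so every point of D
reaches `x` at the same late times. This rules out maps that are constant near a point of the
α-limit set. -/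
theorem mem_alphaLimitSet_of_iterate_const {D : Set Y} {m : ℕ}
    (hD : ∀ z ∈ D, ∀ z' ∈ D, f^[m] z = f^[m] z') {y z : Y} (hy : y ∈ alphaLimitSet f x)
    (hyD : D ∈ 𝓝 y) (hz : z ∈ D) : z ∈ alphaLimitSet f x := by
  rw [mem_alphaLimitSet] at hy ⊢
  intro U hU n
  obtain ⟨k, hk, w, hw, hwx⟩ := hy D hyD (n + m)
  refine ⟨k, by omega, z, mem_of_mem_nhds hU, ?_⟩
  obtain ⟨j, rfl⟩ := Nat.exists_eq_add_of_le' (show m ≤ k by omega)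
  rw [Function.iterate_add_apply] at hwx ⊢
  rwa [hD z hz w hw]

end AlphaLimit

/-! ### Maps into sums, path components, and a coordinate off the sine curve -/

section Sum

variable {A X Y : Type*} [TopologicalSpace A] [TopologicalSpace X] [TopologicalSpace Y]
  [PreconnectedSpace A]

theorem exists_eq_inr_of_preconnected {f : A → X ⊕ Y} (hf : Continuous f) {a : A} {y : Y}
    (ha : f a = Sum.inr y) : ∃ h : A → Y, Continuous h ∧ ∀ a, f a = Sum.inr (h a) := by
  have key : ∀ b, ∃ y, Sum.inr y = f b := fun b =>
    (isPreconnected_range hf).subset_isClopen (isClopen_range_inr (X := X) (Y := Y))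
      ⟨f a, ⟨a, rfl⟩, y, ha.symm⟩ ⟨b, rfl⟩
  choose h hh using key
  refine ⟨h, ?_, fun b => (hh b).symm⟩
  rw [(IsOpenEmbedding.inr (X := X)).isEmbedding.continuous_iff]
  exact hf.congr fun b => (hh b).symm

theorem exists_eq_inl_of_preconnected {f : A → X ⊕ Y} (hf : Continuous f) {a : A} {x : X}
    (ha : f a = Sum.inl x) : ∃ h : A → X, Continuous h ∧ ∀ a, f a = Sum.inl (h a) := by
  have key : ∀ b, ∃ x, Sum.inl x = f b := fun b =>
    (isPreconnected_range hf).subset_isClopen (isClopen_range_inl (X := X) (Y := Y))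
      ⟨f a, ⟨a, rfl⟩, x, ha.symm⟩ ⟨b, rfl⟩
  choose h hh using key
  refine ⟨h, ?_, fun b => (hh b).symm⟩
  rw [(IsOpenEmbedding.inl (Y := Y)).isEmbedding.continuous_iff]
  exact hf.congr fun b => (hh b).symm

end Sum

theorem dense_fst_pos : Dense {p : closure sineCurve | 0 < p.1.1} := by
  intro p
  rw [closure_subtype]
  refine closure_mono (fun v hv => ?_) p.2
  exact ⟨⟨v, subset_closure hv⟩, hv.1, rfl⟩

instance : PreconnectedSpace SineChain :=
  ⟨SineChain.mk_surjective.range_eq ▸ isPreconnected_range SineChain.continuous_mk⟩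

instance : PreconnectedSpace extendedSineCurve := by
  refine ⟨(isPreconnected_of_forall (sineIncl sineLow) fun p _ => ?_)⟩
  rcases le_or_gt p.1.1 0 with hp | hp
  · obtain ⟨γ⟩ := joined_sineIncl_sineLow hp
    exact ⟨range γ, subset_univ _, ⟨0, γ.source⟩, ⟨1, γ.target⟩,
      isPreconnected_range γ.continuous⟩
  · obtain ⟨q, -, rfl⟩ := extendedSineCurve_eq_sineIncl hp
    exact ⟨range sineIncl, subset_univ _, ⟨_, rfl⟩, ⟨_, rfl⟩,
      isPreconnected_range continuous_sineIncl⟩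

/-- The retraction of the chain to its `n`-th curve. -/
def SineChain.retract (n : ℕ) : SineChain → closure sineCurve :=
  Quotient.lift (chainRetract n) (by
    rintro v w (rfl | ⟨h1, h2⟩)
    · rfl
    · rw [chainRetract_arc n h1.1, chainRetract_arc n h2.1])

theorem SineChain.continuous_retract (n : ℕ) : Continuous (SineChain.retract n) :=
  (continuous_chainRetract n).quotient_lift _

/-- The limit point of the chain is a path component. -/
theorem SineChain.eq_limit_of_joined {c : SineChain} (h : Joined SineChain.limit c) :
    c = SineChain.limit := by
  rcases SineChain.cases c with hc | ⟨i, p, rfl⟩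
  · exact hc
  -- The retraction to curve i + 1, rather than i, takes the limit to the lower end and all of curve
  -- i to the end point; these are not joined.
  · have h1 := h.map (SineChain.continuous_retract (i + 1))
    have h2 : SineChain.retract (i + 1) SineChain.limit = sineLow := chainRetract_arc _ rfl
    have h3 : SineChain.retract (i + 1) (SineChain.curve i p) = sineEnd :=
      chainRetract_of_lt (Nat.lt_succ_self i) p
    rw [h2, h3] at h1
    exact absurd (Joined.fst_eq_zero h1 rfl) sineEnd_fst_pos.ne'

/-- A map of the closed sine curve which is constant on the convergence segment factors through an
arc. -/
theorem joined_of_const_segment {Y : Type*} [TopologicalSpace Y] {h : closure sineCurve → Y}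
    (hh : Continuous h) {y : Y} (hy : ∀ p, p.1.1 = 0 → h p = y) (p : closure sineCurve) :
    Joined y (h p) := by
  set q : closure sineCurve → Icc (0 : ℝ) (2 / Real.pi) := fun p => ⟨p.1.1,
    (closure_sineCurve_bounds p.2).1, (closure_sineCurve_bounds p.2).2.1⟩ with hq
  have hqc : Continuous q := by fun_prop
  have hqs : Function.Surjective q := by
    rintro ⟨t, ht0, ht1⟩
    rcases ht0.eq_or_lt with rfl | ht
    · exact ⟨sineLow, rfl⟩
    · exact ⟨⟨(t, Real.sin (1 / t)), subset_closure ⟨ht, ht1, rfl⟩⟩, rfl⟩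
  -- The first coordinate is injective off the segment, so `h` factors through it, and the factor is
  -- continuous on the interval because the projection is a quotient map.
  have hqq := hqc.isClosedMap.isQuotientMap hqc hqs
  obtain ⟨s, hs⟩ := hqs.hasRightInverse
  have hfac : (h ∘ s) ∘ q = h := by
    ext a
    have h1 : (s (q a)).1.1 = a.1.1 := congrArg Subtype.val (hs (q a))
    change h (s (q a)) = h a
    rcases (closure_sineCurve_bounds a.2).1.eq_or_lt with h0 | h0
    · rw [hy a h0.symm, hy _ (h1.trans h0.symm)]
    · congr 1
      refine Subtype.ext (Prod.ext h1 ?_)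
      rw [(mem_sineCurve_of_fst_pos a.2 h0).2.2,
        (mem_sineCurve_of_fst_pos (s (q a)).2 (h1 ▸ h0)).2.2, h1]
  have hsc : Continuous (h ∘ s) := by rwa [hqq.continuous_iff, hfac]
  have : PathConnectedSpace (Icc (0 : ℝ) (2 / Real.pi)) := isPathConnected_iff_pathConnectedSpace.1
    ((convex_Icc _ _).isPathConnected ⟨0, le_rfl, by positivity⟩)
  have hj := (PathConnectedSpace.joined (q sineLow) (q p)).map hsc
  have e : ∀ a, (h ∘ s) (q a) = h a := congrFun hfac
  rwa [e, e, hy sineLow rfl] at hj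

/-- A coordinate on the complement of the sine curve in the extended sine curve. -/
def axisCoord (p : extendedSineCurve) : ℝ := p.1.1 + p.1.2 + 1

theorem continuous_axisCoord : Continuous axisCoord := by unfold axisCoord; fun_prop

theorem extended_nonpos_cases {p : extendedSineCurve} (hp : p.1.1 ≤ 0) :
    p.1.1 = 0 ∨ p.1.2 = -1 := by
  rcases p.2 with h | h
  · exact Or.inl (le_antisymm hp (closure_sineCurve_bounds h).1)
  · exact Or.inr h.2.2

/-- The coordinate runs through [-1, 0] on the horizontal part and through [0, 2] on the vertical
one; both give 0 only at the corner. -/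
theorem axisCoord_injOn {p q : extendedSineCurve} (hp : p.1.1 ≤ 0) (hq : q.1.1 ≤ 0)
    (h : axisCoord p = axisCoord q) : p = q := by
  have hp2 := (extendedSineCurve_bounds p.2).2.2.1
  have hq2 := (extendedSineCurve_bounds q.2).2.2.1
  unfold axisCoord at h
  refine Subtype.ext ?_
  rcases extended_nonpos_cases hp with h1 | h1 <;> rcases extended_nonpos_cases hq with h2 | h2 <;>
    refine Prod.ext ?_ ?_ <;> linarith

theorem isPreconnected_extended_of_image {I : Set ℝ} (hI : I ⊆ Ioc 0 (2 / Real.pi))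
    (h : IsPathConnected I) : IsPreconnected {p : extendedSineCurve | p.1.1 ∈ I} := by
  rw [← IsInducing.subtypeVal.isPreconnected_image]
  convert (isPathConnected_sineCurve_inter hI h).isConnected.isPreconnected using 1
  ext v
  constructor
  · rintro ⟨p, hp, rfl⟩
    exact ⟨mem_sineCurve_of_extended p.2 (hI hp).1, hp⟩
  · rintro ⟨hv, hvI⟩
    exact ⟨⟨v, Or.inl (subset_closure hv)⟩, hvI, rfl⟩

theorem isPreconnected_extended_ge {δ : ℝ} (h : 0 < δ) (h' : δ ≤ 2 / Real.pi) :
    IsPreconnected {p : extendedSineCurve | δ ≤ p.1.1} := by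
  convert isPreconnected_extended_of_image (I := Icc δ (2 / Real.pi))
    (fun x hx => ⟨h.trans_le hx.1, hx.2⟩) ((convex_Icc _ _).isPathConnected ⟨δ, le_rfl, h'⟩)
    using 1
  ext p
  exact ⟨fun h => ⟨h, (extendedSineCurve_bounds p.2).2.1⟩, fun h => h.1⟩

theorem isPreconnected_extended_pos : IsPreconnected {p : extendedSineCurve | 0 < p.1.1} := by
  have hpi := Real.pi_pos
  convert isPreconnected_extended_of_image (I := Ioc 0 (2 / Real.pi)) le_rfl
    ((convex_Ioc _ _).isPathConnected (nonempty_Ioc.2 (by positivity))) using 1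
  ext p
  exact ⟨fun h => ⟨h, (extendedSineCurve_bounds p.2).2.1⟩, fun h => h.1⟩

theorem joined_extended_of_fst_pos {p q : extendedSineCurve} (hp : 0 < p.1.1) (hq : 0 < q.1.1) :
    Joined p q := by
  obtain ⟨p, hp', rfl⟩ := extendedSineCurve_eq_sineIncl hp
  obtain ⟨q, hq', rfl⟩ := extendedSineCurve_eq_sineIncl hq
  exact (joined_of_fst_pos hp' hq').map continuous_sineIncl

/-! ### Invariance of the sine curve under the map of X -/

section ExtendedDynamics

variable {F : extendedSineCurve → extendedSineCurve} {x₀ : extendedSineCurve}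

/-- If the sine curve is mapped into its complement, then points of the interior of its image are
not hit by returning points. -/
theorem iterate_notMem_interior_image (hF : Continuous F)
    (hdense : ∀ y : extendedSineCurve, y.1.1 ≤ 0 → ∀ U ∈ 𝓝 y, ∀ n, ∃ k, n ≤ k ∧ ∃ z ∈ U,
      F^[k] z = x₀)
    (havoid : ∀ K : Set extendedSineCurve, IsCompact K → (∀ p ∈ K, 0 < p.1.1) →
      ∃ N, ∀ k, N ≤ k → ∀ z ∈ K, F^[k] z ≠ x₀)
    (hFL : ∀ p, (F p).1.1 ≤ 0) {y : extendedSineCurve} (hy : y.1.1 ≤ 0) {m : ℕ}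
    (hm : ∀ᶠ z in 𝓝 y, (F^[m] z).1.1 ≤ 0) :
    axisCoord (F^[m] y) ∉ interior ((fun p => axisCoord (F p)) '' {p | 0 < p.1.1}) := by
  intro hint
  obtain ⟨a, b, hab, hnhds, hsub⟩ := exists_Icc_mem_subset_of_mem_nhds
    (mem_interior_iff_mem_nhds.1 hint)
  have hle : a ≤ b := hab.1.trans hab.2
  obtain ⟨p, hp, hpa⟩ := hsub (left_mem_Icc.2 hle)
  obtain ⟨q, hq, hqb⟩ := hsub (right_mem_Icc.2 hle)
  set δ := min p.1.1 q.1.1 with hδ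
  have hδ0 : 0 < δ := lt_min hp hq
  have hδ1 : δ ≤ 2 / Real.pi := (min_le_left _ _).trans (extendedSineCurve_bounds p.2).2.1
  have hKc : IsCompact {r : extendedSineCurve | δ ≤ r.1.1} :=
    (isClosed_le continuous_const (by fun_prop)).isCompact
  -- A compact piece of the sine curve already covers [a, b] by intermediate values.
  have hIVT := (isPreconnected_extended_ge hδ0 hδ1).intermediate_value
    (show p ∈ {r : extendedSineCurve | δ ≤ r.1.1} from min_le_left p.1.1 q.1.1)
    (show q ∈ {r : extendedSineCurve | δ ≤ r.1.1} from min_le_right p.1.1 q.1.1)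
    (continuous_axisCoord.comp hF).continuousOn
  simp only [Function.comp_apply] at hIVT hpa hqb
  rw [hpa, hqb] at hIVT
  obtain ⟨N, hN⟩ := havoid _ hKc fun r hr => hδ0.trans_le hr
  have hU : {z | axisCoord (F^[m] z) ∈ Icc a b} ∈ 𝓝 y :=
    (continuous_axisCoord.comp (hF.iterate m)).continuousAt hnhds
  obtain ⟨k, hk, z, ⟨hz1, hz2⟩, hzx⟩ := hdense y hy _ (inter_mem hU hm) (N + m)
  obtain ⟨r, hr, hrz⟩ := hIVT hz1
  -- Hence `r`, in the compact piece, reaches x₀ after k - m + 1 steps, which is too late.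
  have hrz' : F r = F^[m] z := axisCoord_injOn (hFL r) hz2 hrz
  obtain ⟨j, rfl⟩ := Nat.exists_eq_add_of_le' (show m ≤ k by omega)
  rw [Function.iterate_add_apply, ← hrz', ← Function.iterate_succ_apply] at hzx
  exact hN (j + 1) (by omega) r hr hzx

/-- The sine curve is mapped to itself. -/
theorem fst_pos_of_dense_preimages (hF : Continuous F)
    (hL : ∀ p : extendedSineCurve, p.1.1 ≤ 0 → (F p).1.1 ≤ 0)
    (hdense : ∀ y : extendedSineCurve, y.1.1 ≤ 0 → ∀ U ∈ 𝓝 y, ∀ n, ∃ k, n ≤ k ∧ ∃ z ∈ U,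
      F^[k] z = x₀)
    (havoid : ∀ K : Set extendedSineCurve, IsCompact K → (∀ p ∈ K, 0 < p.1.1) →
      ∃ N, ∀ k, N ≤ k → ∀ z ∈ K, F^[k] z ≠ x₀)
    (hconst : ∀ m, ¬ ∀ p q : extendedSineCurve, 0 < p.1.1 → 0 < q.1.1 → F^[m] p = F^[m] q) :
    ∀ p : extendedSineCurve, 0 < p.1.1 → 0 < (F p).1.1 := by
  by_contra! hex
  obtain ⟨p₀, hp₀, hFp₀⟩ := hex
  have hFL : ∀ p, (F p).1.1 ≤ 0 := by
    intro p
    rcases le_or_gt p.1.1 0 with hp | hp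
    · exact hL p hp
    · exact Joined.fst_nonpos ((joined_extended_of_fst_pos hp₀ hp).map hF) hFp₀
  set e : extendedSineCurve → ℝ := fun p => axisCoord (F p) with he
  have hec : Continuous e := continuous_axisCoord.comp hF
  set I : Set ℝ := e '' {p | 0 < p.1.1} with hI
  have hIconv : Convex ℝ I :=
    (isPreconnected_extended_pos.image _ hec.continuousOn).ordConnected.convex
  have hnot := fun y hy m => iterate_notMem_interior_image (m := m) (y := y) hF hdense havoid hFL hy
  rcases (interior I).eq_empty_or_nonempty with hempty | hne
  -- An interval with empty interior is a point, so F is constant on the sine curve.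
  · refine hconst 1 fun p q hp hq => axisCoord_injOn (hFL p) (hFL q) ?_
    by_contra hpq
    have key : ∀ p q : extendedSineCurve, 0 < p.1.1 → 0 < q.1.1 → ¬ e p < e q := by
      intro p q hp hq hlt
      have hsub : Icc (e p) (e q) ⊆ I := hIconv.ordConnected.out ⟨p, hp, rfl⟩ ⟨q, hq, rfl⟩
      have := interior_mono hsub
      rw [interior_Icc, hempty] at this
      obtain ⟨t, ht⟩ := nonempty_Ioo.2 hlt
      exact this ht
    rcases lt_or_gt_of_ne hpq with h | h
    · exact key p q hp hq h
    · exact key q p hq hp h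
  -- The inverse of `axisCoord` on the vertical segment: coordinate t is height t - 1.
  · set μ : ℝ → extendedSineCurve := fun t => sineIncl (sineSeg (t - 1)) with hμ
    have hμc : Continuous μ :=
      continuous_sineIncl.comp (continuous_sineSeg.comp (continuous_id.sub continuous_const))
    have hμe : ∀ p : extendedSineCurve, p.1.1 ≤ 0 → 0 ≤ axisCoord p → μ (axisCoord p) = p := by
      intro p hp hp'
      have hp0 : p.1.1 = 0 := by
        rcases extended_nonpos_cases hp with h | h
        · exact h
        · unfold axisCoord at hp'
          linarith
      obtain ⟨-, -, h1, h2⟩ := extendedSineCurve_bounds p.2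
      have h3 : axisCoord p - 1 = p.1.2 := by unfold axisCoord; linarith
      refine Subtype.ext ?_
      change (sineSeg (axisCoord p - 1)).1 = p.1
      rw [h3, sineSeg_coe h1 h2]
      exact Prod.ext hp0.symm rfl
    -- A negative value is taken on the horizontal part away from the corner, which is open and off
    -- the sine curve, so m = 0 applies.
    have hJ0 : ∀ t ∈ interior I, 0 ≤ t := by
      intro t ht
      obtain ⟨p, hp, rfl⟩ := interior_subset ht
      by_contra! h
      have h1 : (F p).1.1 < 0 := by
        have := (extendedSineCurve_bounds (F p).2).2.2.1
        simp only [he, axisCoord] at h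
        linarith
      refine hnot (F p) (hFL p) 0 ?_ ht
      have : IsOpen {z : extendedSineCurve | z.1.1 < 0} := isOpen_lt (by fun_prop) continuous_const
      exact mem_of_superset (this.mem_nhds h1) fun z hz => le_of_lt (α := ℝ) hz
    have hψ1 : ∀ t ∈ interior I, e (μ t) ∉ interior I := by
      intro t ht
      exact hnot (μ t) le_rfl 1 (Eventually.of_forall hFL)
    have hψ2 : ∀ t, e (μ t) ∈ closure I := by
      intro t
      have h1 : sineSeg (t - 1) ∈ closure {p : closure sineCurve | 0 < p.1.1} := dense_fst_pos _
      have h2 := image_closure_subset_closure_image (hec.comp continuous_sineIncl) ⟨_, h1, rfl⟩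
      refine closure_mono ?_ h2
      rintro _ ⟨p, hp, rfl⟩
      exact ⟨sineIncl p, hp, rfl⟩
    have hJpre : IsPreconnected (interior I) := hIconv.interior.isPreconnected
    -- The connected set e (μ (interior I)) lies in the closure of I and misses its interior, so it
    -- cannot contain two points. Consequently F² is constant on the sine curve.
    have key : ∀ s ∈ interior I, ∀ t ∈ interior I, ¬ e (μ s) < e (μ t) := by
      intro s hs t ht hlt
      obtain ⟨r, hr⟩ := nonempty_Ioo.2 hlt
      have h1 : Ioo (e (μ s)) (e (μ t)) ⊆ interior I := by
        rw [← hIconv.interior_closure_eq_interior_of_nonempty_interior hne]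
        refine interior_maximal ?_ isOpen_Ioo
        exact Ioo_subset_Icc_self.trans (hIconv.closure.ordConnected.out (hψ2 s) (hψ2 t))
      obtain ⟨u, hu, hur⟩ := hJpre.intermediate_value hs ht (hec.comp hμc).continuousOn
        (Ioo_subset_Icc_self hr)
      exact hψ1 u hu (by
        have : e (μ u) = r := hur
        rw [this]; exact h1 hr)
    obtain ⟨s, hs⟩ := hne
    have hcl : I ⊆ closure (interior I) := by
      rw [hIconv.closure_interior_eq_closure_of_nonempty_interior ⟨s, hs⟩]
      exact subset_closure
    have hall : ∀ t ∈ I, 0 ≤ t ∧ e (μ t) = e (μ s) := by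
      intro t ht
      refine closure_minimal (s := interior I) (t := {t | 0 ≤ t ∧ e (μ t) = e (μ s)}) ?_ ?_ (hcl ht)
      · intro t ht
        exact ⟨hJ0 t ht, le_antisymm (not_lt.1 (key s hs t ht)) (not_lt.1 (key t ht s hs))⟩
      · exact (isClosed_le continuous_const continuous_id).inter
          (isClosed_eq (hec.comp hμc) continuous_const)
    refine hconst 2 fun p q hp hq => axisCoord_injOn (hFL _) (hFL _) ?_
    have h2 : ∀ p : extendedSineCurve, 0 < p.1.1 → axisCoord (F (F p)) = e (μ s) := by
      intro p hp
      obtain ⟨h3, h4⟩ := hall (e p) ⟨p, hp, rfl⟩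
      rw [← h4, hμe (F p) (hFL p) h3]
    exact (h2 p hp).trans (h2 q hq).symm

end ExtendedDynamics

/-! ### Maps from the chain to the extended sine curve -/

theorem SineChain.limit_mem_closure (n : ℕ) :
    SineChain.limit ∈ closure (⋃ i : ℕ, range (SineChain.curve (n + i))) := by
  have h := image_closure_subset_closure_image SineChain.continuous_mk
    ⟨_, mem_closure_iUnion_chainCurve n (w := arcPoint sineLow) rfl, rfl⟩
  rw [SineChain.mk_eq_limit.2 rfl] at h
  refine closure_mono ?_ h
  rintro _ ⟨w, hw, rfl⟩
  obtain ⟨i, p, rfl⟩ := mem_iUnion.1 hw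
  exact mem_iUnion.2 ⟨i, p, rfl⟩

theorem SineChain.isPreconnected_iUnion_curve (n : ℕ) :
    IsPreconnected (⋃ i : ℕ, range (SineChain.curve (n + i))) := by
  have h := (isPreconnected_iUnion_chainCurve n).image _ SineChain.continuous_mk.continuousOn
  rw [image_iUnion] at h
  simp_rw [← range_comp] at h
  exact h

/-- On the compact complement of V, if it is nonempty, the first coordinate has a positive minimum.
-/
theorem exists_fst_lt_subset {V : Set (closure sineCurve)} (hV : IsOpen V)
    (hseg : ∀ p, p.1.1 = 0 → p ∈ V) :
    ∃ δ, 0 < δ ∧ δ ≤ 2 / Real.pi ∧ ∀ p : closure sineCurve, p.1.1 < δ → p ∈ V := by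
  have hpi := Real.pi_pos
  rcases Vᶜ.eq_empty_or_nonempty with h | h
  · exact ⟨2 / Real.pi, by positivity, le_rfl, fun p _ => by
      by_contra hp
      exact h.subset hp⟩
  · obtain ⟨q, hq, hmin⟩ := hV.isClosed_compl.isCompact.exists_isMinOn h
      (f := fun p : closure sineCurve => p.1.1) (by fun_prop)
    obtain ⟨h0, h1, -⟩ := closure_sineCurve_bounds q.2
    refine ⟨q.1.1, lt_of_le_of_ne h0 fun h => hq (hseg q h.symm), h1, fun p hp => ?_⟩
    by_contra hpV
    exact absurd (hmin hpV) (not_le.2 hp)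

/-- A map of the closed sine curve to the extended one which is constant on the convergence segment,
with value outside the sine curve, does not map the sine curve to itself. -/
theorem not_fst_pos_of_const_segment {h : closure sineCurve → extendedSineCurve}
    (hh : Continuous h) {e : extendedSineCurve} (he : e.1.1 ≤ 0)
    (hseg : ∀ p, p.1.1 = 0 → h p = e) : ¬ ∀ p, 0 < p.1.1 → 0 < (h p).1.1 := by
  intro hpos
  obtain ⟨δ, hδ, hδ', hV⟩ := exists_fst_lt_subset
    (V := h ⁻¹' Metric.ball e 1) (Metric.isOpen_ball.preimage hh) fun p hp => by
      rw [mem_preimage, hseg p hp]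
      exact Metric.mem_ball_self one_pos
  set D : Set (closure sineCurve) := {p | p.1 ∈ sineCurve ∧ p.1.1 ∈ Ioo 0 δ} with hD
  have hDpre : IsPreconnected D := by
    rw [← IsInducing.subtypeVal.isPreconnected_image]
    convert (isPathConnected_sineCurve_Ioo hδ hδ').isConnected.isPreconnected using 1
    ext v
    exact ⟨by rintro ⟨p, hp, rfl⟩; exact hp, fun hv => ⟨⟨v, subset_closure hv.1⟩, hv, rfl⟩⟩
  have hlow : sineLow ∈ closure D := by
    have h1 := dense_fst_pos.open_subset_closure_inter
      (show IsOpen {p : closure sineCurve | p.1.1 < δ} from isOpen_lt (by fun_prop) continuous_const)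
      (show (sineLow : ℝ × ℝ).1 < δ from hδ)
    refine closure_mono ?_ h1
    rintro p ⟨hp1, hp2⟩
    exact ⟨mem_sineCurve_of_fst_pos p.2 hp2, hp2, hp1⟩
  have hvc : Continuous fun p => (h p : ℝ × ℝ) := continuous_subtype_val.comp hh
  refine not_mapsTo_ball_sineCurve (Q := (fun p => (h p : ℝ × ℝ)) '' D) (e := e) ?_
    (hDpre.image _ hvc.continuousOn) ?_ he ?_
  · rintro _ ⟨p, hp, rfl⟩
    exact mem_sineCurve_of_extended (h p).2 (hpos p hp.2.1)
  · rw [← hseg sineLow rfl]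
    exact image_closure_subset_closure_image hvc ⟨_, hlow, rfl⟩
  · rintro _ ⟨p, hp, rfl⟩
    exact hV p hp.2.2

/-- The chain cannot be mapped to the extended sine curve with only the limit point leaving the
sine curve. -/
theorem exists_curve_fst_nonpos {G : SineChain → extendedSineCurve} (hG : Continuous G)
    (hlim : (G SineChain.limit).1.1 ≤ 0) : ∃ i p, (G (SineChain.curve i p)).1.1 ≤ 0 := by
  by_contra! hpos
  obtain ⟨N, hN⟩ := eventually_atTop.1 (SineChain.eventually_range_subset
    (U := G ⁻¹' Metric.ball (G SineChain.limit) 1)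
    (hG.continuousAt (Metric.ball_mem_nhds _ one_pos)))
  have hvc : Continuous fun c => (G c : ℝ × ℝ) := continuous_subtype_val.comp hG
  refine not_mapsTo_ball_sineCurve
    (Q := (fun c => (G c : ℝ × ℝ)) '' ⋃ i : ℕ, range (SineChain.curve (N + i)))
    (e := G SineChain.limit) ?_
    ((SineChain.isPreconnected_iUnion_curve N).image _ hvc.continuousOn)
    (image_closure_subset_closure_image hvc ⟨_, SineChain.limit_mem_closure N, rfl⟩) hlim ?_
  · rintro _ ⟨c, hc, rfl⟩
    obtain ⟨i, p, rfl⟩ := mem_iUnion.1 hc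
    exact mem_sineCurve_of_extended (G _).2 (hpos _ _)
  · rintro _ ⟨c, hc, rfl⟩
    obtain ⟨i, hc⟩ := mem_iUnion.1 hc
    exact hN (N + i) (by omega) hc

/-- A map from the chain to the extended sine curve is constant if it is constant on every connected
compact set, away from the limit point, that is mapped off the sine curve. -/
theorem const_of_const_on_compacts {G : SineChain → extendedSineCurve} (hG : Continuous G)
    (hlim : (G SineChain.limit).1.1 ≤ 0)
    (hK : ∀ K : Set SineChain, IsCompact K → IsPreconnected K → SineChain.limit ∉ K →
      (∀ c ∈ K, (G c).1.1 ≤ 0) → ∀ c ∈ K, ∀ d ∈ K, G c = G d) (c d : SineChain) : G c = G d := by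
  have hGi : ∀ i, Continuous fun p => G (SineChain.curve i p) := fun i =>
    hG.comp (SineChain.continuous_curve i)
  -- Leaving the sine curve spreads through the path component of `p`, and then to its closure,
  -- which is the whole curve.
  have h1 : ∀ i p, 0 < p.1.1 → (G (SineChain.curve i p)).1.1 ≤ 0 →
      ∀ q, (G (SineChain.curve i q)).1.1 ≤ 0 := by
    intro i p hp hGp q
    refine closure_minimal (s := {q : closure sineCurve | 0 < q.1.1}) (fun q hq => ?_)
      (isClosed_le (continuous_fst.comp (continuous_subtype_val.comp (hGi i))) continuous_const)
      (dense_fst_pos q)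
    exact Joined.fst_nonpos ((joined_of_fst_pos hp hq).map (hGi i)) hGp
  have h2 : ∀ i, (∀ p, (G (SineChain.curve i p)).1.1 ≤ 0) →
      ∀ p, (G (SineChain.curve (i + 1) p)).1.1 ≤ 0 := by
    intro i hi
    refine h1 (i + 1) sineEnd sineEnd_fst_pos ?_
    rw [← SineChain.curve_low]
    exact hi _
  -- Backward step: the shared point puts the segment of curve i off the sine curve, where `hK`
  -- makes the map constant on it. If the rest of curve i went into the sine curve, it would have to
  -- oscillate near the segment.
  have h3 : ∀ i, (∀ p, (G (SineChain.curve (i + 1) p)).1.1 ≤ 0) →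
      ∀ p, (G (SineChain.curve i p)).1.1 ≤ 0 := by
    intro i hi
    by_contra hne
    have hpos : ∀ p, 0 < p.1.1 → 0 < (G (SineChain.curve i p)).1.1 := by
      intro p hp
      by_contra! h
      exact hne (h1 i p hp h)
    have hlow : (G (SineChain.curve i sineLow)).1.1 ≤ 0 := by
      rw [SineChain.curve_low]
      exact hi _
    have hseg : ∀ p, p.1.1 = 0 → (G (SineChain.curve i p)).1.1 ≤ 0 := fun p hp =>
      Joined.fst_nonpos ((joined_of_fst_eq_zero rfl hp).map (hGi i)) hlow
    refine not_fst_pos_of_const_segment (hGi i) hlow (fun p hp => ?_) hpos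
    refine hK (SineChain.curve i '' {p | p.1.1 = 0}) ?_ ?_ ?_ ?_ _ ⟨p, hp, rfl⟩ _ ⟨sineLow, rfl, rfl⟩
    · exact (isClosed_eq (by fun_prop) continuous_const).isCompact.image
        (SineChain.continuous_curve i)
    · exact isPathConnected_segment.isConnected.isPreconnected.image _
        (SineChain.continuous_curve i).continuousOn
    · rintro ⟨q, -, hq⟩
      exact SineChain.curve_ne_limit i q hq
    · rintro _ ⟨q, hq, rfl⟩
      exact hseg q hq
  obtain ⟨i, hi⟩ : ∃ i, ∀ p, (G (SineChain.curve i p)).1.1 ≤ 0 := by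
    obtain ⟨i, p, hp⟩ := exists_curve_fst_nonpos hG hlim
    rcases (closure_sineCurve_bounds p.2).1.eq_or_lt with h | h
    · have hlow : (G (SineChain.curve i sineLow)).1.1 ≤ 0 :=
        Joined.fst_nonpos ((joined_of_fst_eq_zero h.symm rfl).map (hGi i)) hp
      rw [SineChain.curve_low] at hlow
      exact ⟨i + 1, h1 _ _ sineEnd_fst_pos hlow⟩
    · exact ⟨i, h1 i p h hp⟩
  have h0 : ∀ p, (G (SineChain.curve 0 p)).1.1 ≤ 0 := by
    induction i with
    | zero => exact hi
    | succ i ih => exact ih (h3 i hi)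
  have hall : ∀ j p, (G (SineChain.curve j p)).1.1 ≤ 0 := by
    intro j
    induction j with
    | zero => exact h0
    | succ j ih => exact h2 j ih
  have hcurve : ∀ j p q, G (SineChain.curve j p) = G (SineChain.curve j q) := by
    intro j p q
    refine hK (range (SineChain.curve j)) (isCompact_range (SineChain.continuous_curve j))
      (isPreconnected_range (SineChain.continuous_curve j)) ?_ ?_ _ ⟨p, rfl⟩ _ ⟨q, rfl⟩
    · rintro ⟨q, hq⟩
      exact SineChain.curve_ne_limit j q hq
    · rintro _ ⟨q, rfl⟩
      exact hall j q
  set e := G (SineChain.curve 0 sineEnd)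
  have hconst : ∀ j p, G (SineChain.curve j p) = e := by
    intro j
    induction j with
    | zero => exact fun p => hcurve 0 p _
    | succ j ih =>
      intro p
      rw [hcurve (j + 1) p sineEnd, ← SineChain.curve_low]
      exact ih _
  have hall' : ∀ c, G c = e := by
    intro c
    rcases SineChain.cases c with rfl | ⟨j, p, rfl⟩
    · refine closure_minimal (t := {c | G c = e}) ?_ (isClosed_eq hG continuous_const)
        (SineChain.limit_mem_closure 0)
      exact iUnion_subset fun i => range_subset_iff.2 (hconst _)
    · exact hconst j p
  rw [hall' c, hall' d]

/-! ### The closed set that is not an α-limit set -/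

/-- The complement of the sine curve together with the limit point of the chain. -/
def badSet : Set (extendedSineCurve ⊕ SineChain) :=
  {y | Sum.elim (fun p => p.1.1 ≤ 0) (fun c => c = SineChain.limit) y}

theorem inl_mem_badSet {p : extendedSineCurve} : Sum.inl p ∈ badSet ↔ p.1.1 ≤ 0 := Iff.rfl

theorem inr_mem_badSet {c : SineChain} : Sum.inr c ∈ badSet ↔ c = SineChain.limit := Iff.rfl

theorem isClosed_badSet : IsClosed badSet := by
  rw [isClosed_sum_iff]
  exact ⟨isClosed_le (by fun_prop : Continuous fun p : extendedSineCurve => p.1.1)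
    continuous_const, isClosed_singleton⟩

section Bad

variable {f : extendedSineCurve ⊕ SineChain → extendedSineCurve ⊕ SineChain}
  {x : extendedSineCurve ⊕ SineChain}

/-- The chain is an open summand, so constancy on it would put all of it in the α-limit set along
with its limit point. -/
theorem not_const_chain (hα : alphaLimitSet f x = badSet) :
    ¬ ∀ c d, f (Sum.inr c) = f (Sum.inr d) := by
  intro h
  have h1 := mem_alphaLimitSet_of_iterate_const (f := f) (x := x) (D := range Sum.inr) (m := 1)
    (y := Sum.inr SineChain.limit) (z := Sum.inr (SineChain.curve 0 sineEnd)) ?_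
    (by rw [hα]; rfl) (isOpen_range_inr.mem_nhds ⟨_, rfl⟩) ⟨_, rfl⟩
  · rw [hα, inr_mem_badSet] at h1
    exact SineChain.curve_ne_limit _ _ h1
  · rintro _ ⟨c, rfl⟩ _ ⟨d, rfl⟩
    exact h c d

/-- Constancy extends to the closed sine curve, which is a neighbourhood of the upper end of the
segment because the horizontal part has height -1. The α-limit set would then contain points of the
sine curve. -/
theorem not_const_sine (hf : Continuous f) (hα : alphaLimitSet f x = badSet) (m : ℕ) :
    ¬ ∀ p q : extendedSineCurve, 0 < p.1.1 → 0 < q.1.1 →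
      f^[m] (Sum.inl p) = f^[m] (Sum.inl q) := by
  intro h
  have hall : ∀ p, f^[m] (Sum.inl (sineIncl p)) = f^[m] (Sum.inl (sineIncl sineEnd)) := by
    intro p
    refine closure_minimal (s := {p : closure sineCurve | 0 < p.1.1})
      (t := {p | f^[m] (Sum.inl (sineIncl p)) = f^[m] (Sum.inl (sineIncl sineEnd))})
      (fun p hp => h _ _ hp sineEnd_fst_pos) ?_ (dense_fst_pos p)
    exact isClosed_eq ((hf.iterate m).comp (continuous_inl.comp continuous_sineIncl))
      continuous_const
  have hnhds : Sum.inl '' range sineIncl ∈ 𝓝 (Sum.inl (sineIncl (sineSeg 1)) :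
      extendedSineCurve ⊕ SineChain) := by
    refine isOpenMap_inl.image_mem_nhds (mem_of_superset
      ((isOpen_lt continuous_const (by fun_prop : Continuous fun p : extendedSineCurve =>
        p.1.2)).mem_nhds (show (-1 : ℝ) < (sineIncl (sineSeg 1)).1.2 from ?_)) ?_)
    · simp [sineIncl, sineSeg]
    · rintro ⟨p, hp | hp⟩ h
      · exact ⟨⟨p, hp⟩, rfl⟩
      · exact absurd hp.2.2 (ne_of_gt h)
  have h1 := mem_alphaLimitSet_of_iterate_const (f := f) (x := x) (D := Sum.inl '' range sineIncl)
    (m := m) (z := Sum.inl (sineIncl sineEnd)) ?_ (by rw [hα]; exact inl_mem_badSet.2 le_rfl) hnhds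
    ⟨_, ⟨_, rfl⟩, rfl⟩
  · rw [hα, inl_mem_badSet] at h1
    exact sineEnd_fst_pos.not_ge h1
  · rintro _ ⟨_, ⟨p, rfl⟩, rfl⟩ _ ⟨_, ⟨q, rfl⟩, rfl⟩
    rw [hall, hall q]

theorem not_isAlphaLimitSet_badSet : ¬ IsAlphaLimitSet badSet := by
  rintro ⟨f, hf, x, hα⟩
  replace hα := hα.symm
  have hfα : ∀ y ∈ badSet, f y ∈ badSet := fun y hy => hα ▸ map_mem_alphaLimitSet hf (hα.symm ▸ hy)
  have hfl : Continuous fun p => f (Sum.inl p) := hf.comp continuous_inl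
  have hfr : Continuous fun c => f (Sum.inr c) := hf.comp continuous_inr
  rcases hlow : f (Sum.inl (sineIncl sineLow)) with p₁ | c₁
  swap
  · obtain ⟨h, hh, hfh⟩ := exists_eq_inr_of_preconnected hfl hlow
    -- The segment goes to the limit point, so the closed sine curve goes into the path component of
    -- that point, which is a single point.
    have hlim : ∀ p, h (sineIncl p) = SineChain.limit := by
      intro p
      refine SineChain.eq_limit_of_joined
        (joined_of_const_segment (hh.comp continuous_sineIncl) (fun q hq => ?_) p)
      have := hfα (Sum.inl (sineIncl q)) (inl_mem_badSet.2 hq.le)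
      rwa [hfh, inr_mem_badSet] at this
    refine not_const_sine hf hα 1 fun p q hp hq => ?_
    obtain ⟨p, -, rfl⟩ := extendedSineCurve_eq_sineIncl hp
    obtain ⟨q, -, rfl⟩ := extendedSineCurve_eq_sineIncl hq
    rw [Function.iterate_one, hfh, hfh, hlim, hlim]
  obtain ⟨F, hF, hfF⟩ := exists_eq_inl_of_preconnected hfl hlow
  have hiter : ∀ k p, f^[k] (Sum.inl p) = Sum.inl (F^[k] p) := fun k p =>
    ((Function.Semiconj.iterate_right (f := Sum.inl) (ga := F) (gb := f)
      (fun p => (hfF p).symm) k) p).symm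
  have hL : ∀ p : extendedSineCurve, p.1.1 ≤ 0 → (F p).1.1 ≤ 0 := by
    intro p hp
    have := hfα (Sum.inl p) hp
    rwa [hfF] at this
  have hLk : ∀ k, ∀ p : extendedSineCurve, p.1.1 ≤ 0 → (F^[k] p).1.1 ≤ 0 := by
    intro k
    induction k with
    | zero => exact fun p hp => hp
    | succ k ih => exact fun p hp => ih _ (hL p hp)
  -- Near the free end of the horizontal part all points are off the sine curve and stay there under
  -- iteration; some of them reach `x`.
  obtain ⟨x₀, rfl, hx₀⟩ : ∃ x₀, x = Sum.inl x₀ ∧ x₀.1.1 ≤ 0 := by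
    have h1 : Sum.inl (tailPoint 1) ∈ alphaLimitSet f x := by
      rw [hα, inl_mem_badSet]
      simp [tailPoint]
    have hU : Sum.inl '' {p : extendedSineCurve | p.1.1 < 0} ∈
        𝓝 (Sum.inl (tailPoint 1) : extendedSineCurve ⊕ SineChain) :=
      isOpenMap_inl.image_mem_nhds ((isOpen_lt (by fun_prop) continuous_const).mem_nhds
        (show (tailPoint 1).1.1 < 0 by simp [tailPoint]))
    obtain ⟨k, -, _, ⟨z, hz, rfl⟩, hzx⟩ := mem_alphaLimitSet.1 h1 _ hU 0
    rw [hiter] at hzx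
    exact ⟨_, hzx.symm, hLk k z (le_of_lt hz)⟩
  have hdense : ∀ y : extendedSineCurve, y.1.1 ≤ 0 → ∀ U ∈ 𝓝 y, ∀ n, ∃ k, n ≤ k ∧ ∃ z ∈ U,
      F^[k] z = x₀ := by
    intro y hy U hU n
    obtain ⟨k, hk, _, ⟨z, hz, rfl⟩, hzx⟩ := mem_alphaLimitSet.1
      (hα.symm ▸ inl_mem_badSet.2 hy : Sum.inl y ∈ alphaLimitSet f (Sum.inl x₀)) _
      (isOpenMap_inl.image_mem_nhds hU) n
    rw [hiter] at hzx
    exact ⟨k, hk, z, hz, Sum.inl_injective hzx⟩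
  have havoid : ∀ K : Set extendedSineCurve, IsCompact K → (∀ p ∈ K, 0 < p.1.1) →
      ∃ N, ∀ k, N ≤ k → ∀ z ∈ K, F^[k] z ≠ x₀ := by
    intro K hK hpos
    obtain ⟨N, hN⟩ := IsCompact.eventually_iterate_ne (f := f) (x := Sum.inl x₀)
      (hK.image continuous_inl) (by
        rw [hα, Set.disjoint_left]
        rintro _ ⟨p, hp, rfl⟩ h
        exact (hpos p hp).not_ge h)
    exact ⟨N, fun k hk z hz h => hN k hk _ ⟨z, hz, rfl⟩ (by rw [hiter, h])⟩
  have hpos := fst_pos_of_dense_preimages hF hL hdense havoid fun m h =>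
    not_const_sine hf hα m fun p q hp hq => by rw [hiter, hiter, h p q hp hq]
  have hposk : ∀ k, ∀ p : extendedSineCurve, 0 < p.1.1 → 0 < (F^[k] p).1.1 := by
    intro k
    induction k with
    | zero => exact fun p hp => hp
    | succ k ih => exact fun p hp => ih _ (hpos p hp)
  rcases hflim : f (Sum.inr SineChain.limit) with p₂ | c₂
  swap
  · obtain ⟨H, -, hfH⟩ := exists_eq_inr_of_preconnected hfr hflim
    have hiterH : ∀ k c, f^[k] (Sum.inr c) = Sum.inr (H^[k] c) := fun k c =>
      ((Function.Semiconj.iterate_right (f := Sum.inr) (ga := H) (gb := f)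
        (fun p => (hfH p).symm) k) c).symm
    -- A chain mapped to itself never reaches x₀, although its limit point is in the α-limit set.
    have h1 : Sum.inr SineChain.limit ∈ alphaLimitSet f (Sum.inl x₀) := by
      rw [hα, inr_mem_badSet]
    obtain ⟨k, -, _, ⟨c, rfl⟩, hc⟩ := mem_alphaLimitSet.1 h1 _
      (isOpen_range_inr.mem_nhds ⟨_, rfl⟩) 0
    rw [hiterH] at hc
    exact Sum.inr_ne_inl hc
  obtain ⟨G, hG, hfG⟩ := exists_eq_inl_of_preconnected hfr hflim
  have hlim : (G SineChain.limit).1.1 ≤ 0 := by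
    have := hfα (Sum.inr SineChain.limit) rfl
    rwa [hfG] at this
  refine not_const_chain hα fun c d => ?_
  rw [hfG, hfG]
  refine congrArg _ (const_of_const_on_compacts hG hlim (fun K hKc hKp hKl hKL => ?_) c d)
  -- If G took two values on K, its image would contain an open piece of the arc, hence a point z
  -- with a late hitting time of x₀. Such a z is a value of G on K, so K itself would contain late
  -- preimages of x₀.
  have key : ∀ c ∈ K, ∀ d ∈ K, ¬ axisCoord (G c) < axisCoord (G d) := by
    intro c hc d hd hlt
    have hIVT := hKp.intermediate_value hc hd (continuous_axisCoord.comp hG).continuousOn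
    obtain ⟨t, ht⟩ := nonempty_Ioo.2 hlt
    obtain ⟨r, hr, rfl⟩ := hIVT (Ioo_subset_Icc_self ht)
    obtain ⟨N, hN⟩ := IsCompact.eventually_iterate_ne (f := f) (x := Sum.inl x₀)
      (hKc.image continuous_inr) (by
        rw [hα, Set.disjoint_left]
        rintro _ ⟨p, hp, rfl⟩ h
        rw [inr_mem_badSet] at h
        exact hKl (h ▸ hp))
    obtain ⟨k, hk, z, hz, hzx⟩ := hdense (G r) (hKL r hr) _
      ((isOpen_Ioo.preimage continuous_axisCoord).mem_nhds ht) N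
    -- The sine curve is invariant and x₀ is off it, so no point of the sine curve reaches x₀.
    have hzL : z.1.1 ≤ 0 := by
      by_contra! h
      have := hposk k z h
      rw [hzx] at this
      exact this.not_ge hx₀
    obtain ⟨s, hs, hsz⟩ := hIVT (Ioo_subset_Icc_self hz)
    have hsz' : G s = z := axisCoord_injOn (hKL s hs) hzL hsz
    refine hN (k + 1) (by omega) _ ⟨s, hs, rfl⟩ ?_
    rw [Function.iterate_succ_apply, hfG, hiter, hsz', hzx]
  intro c hc d hd
  exact axisCoord_injOn (hKL c hc) (hKL d hd)
    (le_antisymm (not_lt.1 (key d hd c hc)) (not_lt.1 (key c hc d hd)))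

end Bad

theorem not_hasAFProperty_collapsedZ : ¬ HasAFProperty CollapsedZ := by
  intro h
  have h1 := hasAFProperty_iff.1 (h.of_homeomorph collapsedHomeoSum)
  exact not_isAlphaLimitSet_badSet (h1 badSet isClosed_badSet)

end

theorem theorem5p4 :
    (CompactSpace spaceZ ∧ TopologicalSpace.MetrizableSpace spaceZ ∧ HasAFProperty spaceZ) ∧
    (CompactSpace (Quotient (collapseSetoid spaceZ limitArc)) ∧
      TopologicalSpace.MetrizableSpace (Quotient (collapseSetoid spaceZ limitArc)) ∧
      ¬ HasAFProperty (Quotient (collapseSetoid spaceZ limitArc))) ∧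
    IsChainOfSineCurves (Quotient (collapseSetoid sineCurvesToArc limitArc)) ∧
    Nonempty (Quotient (collapseSetoid spaceZ limitArc) ≃ₜ
      extendedSineCurve ⊕ Quotient (collapseSetoid sineCurvesToArc limitArc)) :=
  ⟨⟨inferInstance, inferInstance, hasAFProperty_spaceZ⟩,
    ⟨inferInstance, inferInstance, not_hasAFProperty_collapsedZ⟩,
    isChainOfSineCurves_sineChain, ⟨collapsedHomeoSum⟩⟩
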